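/- Let $\mathbb{C}^+=\{z\in\mathbb{C}:\operatorname{Im}z>0\}$, and let $H^2(\mathbb{C}^+)$ be the Hilbert space of analytic functions $f:\mathbb{C}^+\to\mathbb{C}$ with $\|f\|=\sup_{y>0}\left(\int_{\mathbb{R}}|f(x+iy)|^2\,dx\right)^{1/2}<\infty$. Let $\varphi$ be a rational function with complex coefficients that has no poles in $\mathbb{C}^+$, maps $\mathbb{C}^+$ into $\mathbb{C}^+$, and satisfies $\varphi(\infty)=\infty$. Then $C_\varphi f=f\circ\varphi$ defines a bounded operator on $H^2(\mathbb{C}^+)$. For $z\in\mathbb{C}^+$ put $$S_z=\{t\in\mathbb{C}^+ : \overline{\varphi(\overline{t})}=z\}.$$ For every $z\in\mathbb{C}^+$ the set $S_z$ is finite, and for every $f\in H^2(\mathbb{C}^+)$ the function $s\mapsto f(s)/(\overline{\varphi(\overline{s})}-z)$ is meromorphic at each $t\in S_z$. The adjoint of $C_\varphi$ on $H^2(\mathbb{C}^+)$ is given, for all $f\in H^2(\mathbb{C}^+)$ and $z\in\mathbb{C}^+$, by $$(C_\varphi^*f)(z)=\sum_{t\in S_z}\operatorname{Res}\left(\frac{f(s)}{\overline{\varphi(\overline{s})}-z},\,s=t\right).$$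 If moreover, for a given $z\in\mathbb{C}^+$, the function $s\mapsto 1/(\overline{\varphi(\overline{s})}-z)$ has a simple pole at each $t\in S_z$, then the limits below exist and, for all $f\in H^2(\mathbb{C}^+)$, $$(C_\varphi^*f)(z)=\sum_{t\in S_z}\left(\lim_{s\to t}\frac{s-t}{\overline{\varphi(\overline{s})}-z}\right)f(t).$$ The poles are simple in this sense for all but finitely many $z\in\mathbb{C}^+$, so $C_\varphi^*$ is given by the last formula, as a multiple-valued weighted composition operator, off a finite set of $z$. -/

import Mathlib

open MeasureTheory Filter Set Topology
open scoped UpperHalfPlane ComplexConjugate ENNReal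

namespace HalfPlaneHardy

noncomputable section

/-- The restriction of a function on the upper half-plane to the horizontal line of height `y`. -/
def row (F : ℍ → ℂ) (y : ℝ) (x : ℝ) : ℂ := F (UpperHalfPlane.ofComplex (x + y * Complex.I))

/-- `sup_{y > 0} (∫ |F(x + iy)|² dx)^{1/2}`, with values in `[0, ∞]`. -/
def eNorm (F : ℍ → ℂ) : ℝ≥0∞ := ⨆ (y : ℝ) (_ : 0 < y), eLpNorm (row F y) 2 volume

/-- Analyticity on the upper half-plane. -/
def IsAnalytic (F : ℍ → ℂ) : Prop :=
  DifferentiableOn ℂ (F ∘ UpperHalfPlane.ofComplex) {z : ℂ | 0 < z.im}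

lemma isOpen_im_pos : IsOpen {z : ℂ | 0 < z.im} := isOpen_lt continuous_const Complex.continuous_im

lemma IsAnalytic.differentiableAt {F : ℍ → ℂ} (hF : IsAnalytic F) {z : ℂ} (hz : 0 < z.im) :
    DifferentiableAt ℂ (F ∘ UpperHalfPlane.ofComplex) z :=
  (hF z hz).differentiableAt (isOpen_im_pos.mem_nhds hz)

lemma IsAnalytic.continuous_row {F : ℍ → ℂ} (hF : IsAnalytic F) {y : ℝ} (hy : 0 < y) :
    Continuous (row F y) := by
  have h : Continuous fun x : ℝ => (x : ℂ) + y * Complex.I := by fun_prop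
  exact hF.continuousOn.comp_continuous h (fun x => by simpa using hy)

lemma IsAnalytic.aesm_row {F : ℍ → ℂ} (hF : IsAnalytic F) {y : ℝ} (hy : 0 < y) (μ : Measure ℝ) :
    AEStronglyMeasurable (row F y) μ := (hF.continuous_row hy).aestronglyMeasurable

lemma row_add (F G : ℍ → ℂ) (y : ℝ) : row (F + G) y = row F y + row G y := rfl
lemma row_sub (F G : ℍ → ℂ) (y : ℝ) : row (F - G) y = row F y - row G y := rfl
lemma row_smul (c : ℂ) (F : ℍ → ℂ) (y : ℝ) : row (c • F) y = c • row F y := rfl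

lemma row_le_eNorm (F : ℍ → ℂ) {y : ℝ} (hy : 0 < y) : eLpNorm (row F y) 2 volume ≤ eNorm F :=
  le_iSup₂ (f := fun (y : ℝ) (_ : 0 < y) => eLpNorm (row F y) 2 volume) y hy

lemma eNorm_zero : eNorm 0 = 0 := by
  have : ∀ y, row 0 y = 0 := fun y => rfl
  simp [eNorm, this]

lemma eNorm_add_le {F G : ℍ → ℂ} (hF : IsAnalytic F) (hG : IsAnalytic G) :
    eNorm (F + G) ≤ eNorm F + eNorm G := by
  refine iSup₂_le fun y hy => ?_
  rw [row_add]
  exact (eLpNorm_add_le (hF.aesm_row hy _) (hG.aesm_row hy _) (by norm_num)).trans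
    (add_le_add (row_le_eNorm F hy) (row_le_eNorm G hy))

lemma eNorm_smul (c : ℂ) (F : ℍ → ℂ) : eNorm (c • F) = ‖c‖ₑ * eNorm F := by
  simp only [eNorm, row_smul, eLpNorm_const_smul, ENNReal.mul_iSup]

lemma eNorm_neg (F : ℍ → ℂ) : eNorm (-F) = eNorm F := by
  have := eNorm_smul (-1) F
  simpa using this

/-- The analytic functions `F` on the upper half-plane with `sup_{y>0} ∫ |F(x+iy)|² dx < ∞`. -/
def hardySubmodule : Submodule ℂ (ℍ → ℂ) where
  carrier := {F | IsAnalytic F ∧ eNorm F < ∞}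
  add_mem' := fun {F G} hF hG =>
    ⟨hF.1.add hG.1, (eNorm_add_le hF.1 hG.1).trans_lt (ENNReal.add_lt_top.2 ⟨hF.2, hG.2⟩)⟩
  zero_mem' := ⟨differentiableOn_const 0, by simp [eNorm_zero]⟩
  smul_mem' := fun c F hF => ⟨hF.1.const_smul c, by
    rw [eNorm_smul]; exact ENNReal.mul_lt_top enorm_lt_top hF.2⟩

lemma eNorm_eq_zero {F : ℍ → ℂ} (hF : IsAnalytic F) (h : eNorm F = 0) : F = 0 := by
  funext z
  have hz : 0 < z.im := z.im_pos
  have h0 : eLpNorm (row F z.im) 2 volume = 0 := le_antisymm (h ▸ row_le_eNorm F hz) bot_le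
  rw [eLpNorm_eq_zero_iff (hF.aesm_row hz _) (by norm_num)] at h0
  have h1 := (hF.continuous_row hz).ae_eq_iff_eq (g := 0) volume continuous_const |>.1 h0
  have h2 := congrFun h1 z.re
  have h3 : ((z.re : ℂ) + z.im * Complex.I) = z := by
    apply Complex.ext <;> simp
  simpa [row, h3] using h2

/-- `y ↦ ∫ |F(x+iy)|² dx` is non-increasing. -/
lemma eLpNorm_row_antitone {F : ℍ → ℂ} (hF : IsAnalytic F) (hfin : eNorm F < ∞) {δ y : ℝ}
    (hδ : 0 < δ) (hy : δ ≤ y) : eLpNorm (row F y) 2 volume ≤ eLpNorm (row F δ) 2 volume := by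
  have hy0 : 0 < y := hδ.trans_le hy
  set f : ℂ → ℂ := F ∘ UpperHalfPlane.ofComplex with hf
  have hfd : DifferentiableOn ℂ f {z : ℂ | 0 < z.im} := hF
  have key : ∀ n : ℕ, eLpNorm (row F y) 2 (volume.restrict (uIoc (-(n:ℝ)) n)) ≤
      eLpNorm (row F δ) 2 volume := by
    intro n
    set S := uIoc (-(n:ℝ)) n
    set A := eLpNorm (row F y) 2 (volume.restrict S) with hA
    have hAfin : A < ∞ := (eLpNorm_restrict_le _ _ _ _).trans_lt ((row_le_eNorm F hy0).trans_lt hfin)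
    let G : ℂ → ℂ := fun ζ => ∫ x : ℝ in (-(n:ℝ))..n, f (x + ζ) * conj (row F y x)
    have hGbound : ∀ ζ : ℂ, 0 < ζ.im → ‖G ζ‖ₑ ≤ eLpNorm (row F ζ.im) 2 volume * A := by
      intro ζ hζ
      have e1 : (fun x : ℝ => f (x + ζ)) = fun x => row F ζ.im (x + ζ.re) := by
        funext x
        simp only [hf, row, Function.comp]
        congr 2
        apply Complex.ext <;> simp
      have hsh : MeasurePreserving (fun x : ℝ => x + ζ.re) volume volume :=
        measurePreserving_add_right volume ζ.re
      have e2 : eLpNorm (fun x : ℝ => f (x + ζ)) 2 volume = eLpNorm (row F ζ.im) 2 volume := by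
        rw [e1]
        exact eLpNorm_comp_measurePreserving (hF.aesm_row hζ _) hsh
      have c1 : Continuous (fun x : ℝ => f (x + ζ)) := by
        rw [e1]; exact (hF.continuous_row hζ).comp (by fun_prop)
      have c2 : Continuous (fun x : ℝ => conj (row F y x)) :=
        Complex.continuous_conj.comp (hF.continuous_row hy0)
      have e3 : ‖G ζ‖ₑ = ‖∫ x : ℝ in S, f (x + ζ) * conj (row F y x)‖ₑ := by
        rw [← ofReal_norm, ← ofReal_norm]
        congr 1
        exact intervalIntegral.norm_intervalIntegral_eq _ _ _ _
      rw [e3]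
      calc _ ≤ ∫⁻ x in S, ‖f (x + ζ) * conj (row F y x)‖ₑ := enorm_integral_le_lintegral_enorm _
        _ = eLpNorm ((fun x : ℝ => f (x + ζ)) • (fun x : ℝ => conj (row F y x))) 1
            (volume.restrict S) := by
            rw [eLpNorm_one_eq_lintegral_enorm]; rfl
        _ ≤ eLpNorm (fun x : ℝ => f (x + ζ)) 2 (volume.restrict S) *
            eLpNorm (fun x : ℝ => conj (row F y x)) 2 (volume.restrict S) :=
            eLpNorm_smul_le_mul_eLpNorm c2.aestronglyMeasurable c1.aestronglyMeasurable
        _ ≤ _ := by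
            refine mul_le_mul' ((eLpNorm_restrict_le _ _ _ _).trans e2.le) (le_of_eq ?_)
            refine eLpNorm_congr_norm_ae (Eventually.of_forall fun x => ?_)
            simp
    have hGdiff : DifferentiableOn ℂ G {z : ℂ | 0 < z.im} := by
      intro ζ₀ hζ₀
      have hζ₀' : 0 < ζ₀.im := hζ₀
      obtain ⟨ε, hε, hball⟩ := Metric.isOpen_iff.1 isOpen_im_pos ζ₀ hζ₀
      have hball2 : Metric.closedBall ζ₀ (ε/2) ⊆ {z : ℂ | 0 < z.im} :=
        (Metric.closedBall_subset_ball (by linarith)).trans hball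
      have him : ∀ x : ℝ, ∀ ζ ∈ Metric.closedBall ζ₀ (ε/2), 0 < ((x:ℂ) + ζ).im := by
        intro x ζ hζ
        simpa using hball2 hζ
      have hdc : ContinuousOn (deriv f) {z : ℂ | 0 < z.im} :=
        (hfd.deriv isOpen_im_pos).continuousOn
      have hK : IsCompact ((fun p : ℝ × ℂ => (p.1 : ℂ) + p.2) ''
          (Icc (-(n:ℝ)) n ×ˢ Metric.closedBall ζ₀ (ε/2))) :=
        (isCompact_Icc.prod (isCompact_closedBall _ _)).image (by fun_prop)
      obtain ⟨M, hM⟩ := hK.exists_bound_of_continuousOn (f := deriv f) (hdc.mono (by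
        rintro _ ⟨⟨x, ζ⟩, ⟨_, h2⟩, rfl⟩
        exact him x ζ h2))
      have cy : Continuous (fun x : ℝ => conj (row F y x)) :=
        Complex.continuous_conj.comp (hF.continuous_row hy0)
      have cont1 : ∀ ζ ∈ Metric.closedBall ζ₀ (ε/2),
          Continuous (fun x : ℝ => f (x + ζ) * conj (row F y x)) := fun ζ hζ =>
        (hfd.continuousOn.comp_continuous (by fun_prop) (fun x => him x ζ hζ)).mul cy
      have hm : ζ₀ ∈ Metric.closedBall ζ₀ (ε/2) := Metric.mem_closedBall_self (by linarith)
      have := (intervalIntegral.hasDerivAt_integral_of_dominated_loc_of_deriv_le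
        (μ := volume) (a := -(n:ℝ)) (b := n)
        (F := fun ζ x => f ((x:ℝ) + ζ) * conj (row F y x))
        (F' := fun ζ x => deriv f ((x:ℝ) + ζ) * conj (row F y x)) (x₀ := ζ₀)
        (s := Metric.closedBall ζ₀ (ε/2)) (bound := fun x => M * ‖conj (row F y x)‖)
        (Metric.closedBall_mem_nhds _ (by linarith)) ?_ ?_ ?_ ?_ ?_ ?_).2
      · exact this.differentiableAt.differentiableWithinAt
      · filter_upwards [Metric.closedBall_mem_nhds ζ₀ (show 0 < ε/2 by linarith)] with ζ hζ
        exact (cont1 ζ hζ).aestronglyMeasurable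
      · exact (cont1 ζ₀ hm).intervalIntegrable _ _
      · exact ((hdc.comp_continuous (by fun_prop)
          (fun x => him x ζ₀ hm)).mul cy).aestronglyMeasurable
      · refine Eventually.of_forall fun x hx ζ hζ => ?_
        rw [norm_mul]
        refine mul_le_mul_of_nonneg_right (hM _ ⟨(x, ζ), ⟨?_, hζ⟩, rfl⟩) (norm_nonneg _)
        rw [uIoc_of_le (by linarith [(Nat.cast_nonneg n : (0:ℝ) ≤ n)])] at hx
        exact Ioc_subset_Icc_self hx
      · exact (continuous_const.mul cy.norm).intervalIntegrable _ _
      · refine Eventually.of_forall fun x hx ζ hζ => ?_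
        have h1 : HasDerivAt f (deriv f (x + ζ)) (x + ζ) :=
          (hF.differentiableAt (him x ζ hζ)).hasDerivAt
        have h2 : HasDerivAt (fun ζ : ℂ => (x:ℂ) + ζ) 1 ζ := (hasDerivAt_id ζ).const_add _
        have h3 := h1.comp ζ h2
        simpa using h3.mul_const (conj (row F y x))
    have hGy : ‖G (y * Complex.I)‖ₑ = A ^ 2 := by
      have e3 : ‖G (y * Complex.I)‖ₑ = ‖∫ x : ℝ in S, f (x + y * Complex.I) * conj (row F y x)‖ₑ := by
        rw [← ofReal_norm, ← ofReal_norm]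
        congr 1
        exact intervalIntegral.norm_intervalIntegral_eq _ _ _ _
      have e4 : ∀ x : ℝ, f (x + y * Complex.I) * conj (row F y x) = ((‖row F y x‖ ^ 2 : ℝ) : ℂ) := by
        intro x
        have : f (x + y * Complex.I) = row F y x := rfl
        rw [this, Complex.mul_conj, Complex.normSq_eq_norm_sq]
      rw [e3]
      simp_rw [e4]
      rw [integral_complex_ofReal, ← ofReal_norm, Complex.norm_real, Real.norm_of_nonneg
        (integral_nonneg fun x => by positivity), ofReal_integral_eq_lintegral_ofReal]
      · have := eLpNorm_nnreal_pow_eq_lintegral (f := row F y) (μ := volume.restrict S)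
          (p := 2) (by norm_num)
        rw [hA]
        have h2 : ((2 : NNReal) : ℝ≥0∞) = 2 := rfl
        have h3 : ((2 : NNReal) : ℝ) = 2 := rfl
        rw [h2, h3] at this
        rw [← ENNReal.rpow_natCast]
        push_cast
        rw [this]
        refine lintegral_congr fun x => ?_
        rw [ENNReal.ofReal_pow (norm_nonneg _), ofReal_norm, ← ENNReal.rpow_natCast]
        norm_num
      · have : Continuous fun x => ‖row F y x‖ ^ 2 := ((hF.continuous_row hy0).norm.pow 2)
        exact (this.intervalIntegrable (-(n:ℝ)) n).def'
      · exact Eventually.of_forall fun x => by positivity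
    -- the maximum principle on the half-plane of height `δ`
    have hPL : ‖G (y * Complex.I)‖ ≤ (eLpNorm (row F δ) 2 volume * A).toReal := by
      let g : ℂ → ℂ := fun w => G (Complex.I * (δ + w))
      have hfinδ : ∀ t : ℝ, 0 < t → eLpNorm (row F t) 2 volume * A < ∞ := fun t ht =>
        ENNReal.mul_lt_top ((row_le_eNorm F ht).trans_lt hfin) hAfin
      have hbd : ∀ ζ : ℂ, 0 < ζ.im → ‖G ζ‖ ≤ (eLpNorm (row F ζ.im) 2 volume * A).toReal := by
        intro ζ hζ
        have := ENNReal.toReal_mono (hfinδ _ hζ).ne (hGbound ζ hζ)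
        simpa using this
      have hbd2 : ∀ ζ : ℂ, 0 < ζ.im → ‖G ζ‖ ≤ (eNorm F * A).toReal := fun ζ hζ =>
        (hbd ζ hζ).trans (ENNReal.toReal_mono (ENNReal.mul_lt_top hfin hAfin).ne
          (mul_le_mul_left (row_le_eNorm F hζ) _))
      have himw : ∀ w : ℂ, (Complex.I * (δ + w)).im = δ + w.re := by intro w; simp
      have hgd : DiffContOnCl ℂ g {w | 0 < w.re} := by
        apply DifferentiableOn.diffContOnCl
        rw [Complex.closure_setOfPred_lt_re]
        refine hGdiff.comp (by fun_prop) fun w hw => ?_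
        have : 0 ≤ w.re := hw
        show 0 < (Complex.I * (δ + w)).im
        rw [himw]; linarith
      have hgb : ∀ w : ℂ, 0 < w.re → ‖g w‖ ≤ (eNorm F * A).toReal := fun w hw =>
        hbd2 _ (by rw [himw]; linarith)
      have := PhragmenLindelof.right_half_plane_of_bounded_on_real (f := g)
        (C := (eLpNorm (row F δ) 2 volume * A).toReal) (z := ((y - δ : ℝ) : ℂ)) hgd
        ⟨1, by norm_num, 0, ?_⟩ ?_ ?_ ?_
      · have e : Complex.I * (δ + ((y - δ : ℝ) : ℂ)) = y * Complex.I := by push_cast; ring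
        simpa only [g, e] using this
      · refine Asymptotics.IsBigO.of_bound (eNorm F * A).toReal ?_
        refine Eventually.filter_mono inf_le_right ?_
        rw [eventually_principal]
        intro w hw
        simpa using hgb w hw
      · refine ⟨(eNorm F * A).toReal, ?_⟩
        rw [eventually_map]
        filter_upwards [eventually_gt_atTop 0] with x hx
        exact hgb x (by simpa using hx)
      · intro x
        have e : (Complex.I * (δ + (x * Complex.I))).im = δ := by rw [himw]; simp
        have := hbd (Complex.I * (δ + (x * Complex.I))) (by rw [e]; exact hδ)
        rwa [e] at this
      · simpa using hy
    have hPL' : A ^ 2 ≤ eLpNorm (row F δ) 2 volume * A := by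
      rw [← hGy, ← ofReal_norm]
      have := ENNReal.ofReal_le_ofReal hPL
      rwa [ENNReal.ofReal_toReal] at this
      exact (ENNReal.mul_lt_top ((row_le_eNorm F hδ).trans_lt hfin) hAfin).ne
    by_cases hA0 : A = 0
    · rw [hA0]; exact bot_le
    · rw [sq] at hPL'
      exact (ENNReal.mul_le_mul_iff_left hA0 hAfin.ne).1 hPL'
  have hlim := Lp.eLpNorm_lim_le_liminf_eLpNorm (p := 2) (μ := (volume : Measure ℝ))
    (f := fun n : ℕ => (uIoc (-(n:ℝ)) n).indicator (row F y))
    (fun n => (hF.aesm_row hy0 _).indicator measurableSet_uIoc) (row F y) ?_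
  · refine hlim.trans ?_
    refine liminf_le_of_le (by isBoundedDefault) (fun b hb => ?_)
    obtain ⟨n, hn⟩ := hb.exists
    refine hn.trans ?_
    rw [eLpNorm_indicator_eq_eLpNorm_restrict measurableSet_uIoc]
    exact key n
  · refine Eventually.of_forall fun x => ?_
    refine tendsto_const_nhds.congr' ?_
    obtain ⟨N, hN⟩ := exists_nat_gt |x|
    filter_upwards [eventually_ge_atTop N] with n hn
    have : |x| < n := hN.trans_le (by exact_mod_cast hn)
    rw [indicator_of_mem]
    rw [uIoc_of_le (by linarith [abs_nonneg x])]
    exact ⟨(abs_lt.1 this).1, (abs_lt.1 this).2.le⟩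

lemma tendsto_eLpNorm_row {F : ℍ → ℂ} (hF : IsAnalytic F) (hfin : eNorm F < ∞) :
    Tendsto (fun n : ℕ => eLpNorm (row F (1 / ((n : ℝ) + 1))) 2 volume) atTop (𝓝 (eNorm F)) := by
  have hpos : ∀ n : ℕ, (0:ℝ) < 1 / ((n : ℝ) + 1) := fun n => by positivity
  have hmono : Monotone fun n : ℕ => eLpNorm (row F (1 / ((n : ℝ) + 1))) 2 volume := by
    intro m n hmn
    refine eLpNorm_row_antitone hF hfin (hpos n) ?_
    exact one_div_le_one_div_of_le (by positivity) (by gcongr)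
  have hsup : eNorm F = ⨆ n : ℕ, eLpNorm (row F (1 / ((n : ℝ) + 1))) 2 volume := by
    refine le_antisymm (iSup₂_le fun y hy => ?_) (iSup_le fun n => row_le_eNorm F (hpos n))
    obtain ⟨n, hn⟩ := exists_nat_one_div_lt hy
    exact (eLpNorm_row_antitone hF hfin (hpos n) hn.le).trans
      (le_iSup (fun n : ℕ => eLpNorm (row F (1 / ((n : ℝ) + 1))) 2 volume) n)
  rw [hsup]
  exact tendsto_atTop_iSup hmono

lemma parallelogram_row {F G : ℍ → ℂ} (hF : F ∈ hardySubmodule) (hG : G ∈ hardySubmodule)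
    {y : ℝ} (hy : 0 < y) :
    (eLpNorm (row (F + G) y) 2 volume).toReal * (eLpNorm (row (F + G) y) 2 volume).toReal +
      (eLpNorm (row (F - G) y) 2 volume).toReal * (eLpNorm (row (F - G) y) 2 volume).toReal =
    2 * ((eLpNorm (row F y) 2 volume).toReal * (eLpNorm (row F y) 2 volume).toReal +
      (eLpNorm (row G y) 2 volume).toReal * (eLpNorm (row G y) 2 volume).toReal) := by
  have mF : MemLp (row F y) 2 volume := ⟨hF.1.aesm_row hy _, (row_le_eNorm F hy).trans_lt hF.2⟩
  have mG : MemLp (row G y) 2 volume := ⟨hG.1.aesm_row hy _, (row_le_eNorm G hy).trans_lt hG.2⟩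
  have := parallelogram_law_with_norm ℂ (mF.toLp _) (mG.toLp _)
  rw [← MemLp.toLp_add, ← MemLp.toLp_sub] at this
  simpa only [Lp.norm_toLp, sq, row_add, row_sub] using this

lemma parallelogram_eNorm {F G : ℍ → ℂ} (hF : F ∈ hardySubmodule) (hG : G ∈ hardySubmodule) :
    (eNorm (F + G)).toReal * (eNorm (F + G)).toReal +
      (eNorm (F - G)).toReal * (eNorm (F - G)).toReal =
    2 * ((eNorm F).toReal * (eNorm F).toReal + (eNorm G).toReal * (eNorm G).toReal) := by
  have t : ∀ {H : ℍ → ℂ}, H ∈ hardySubmodule → Tendsto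
      (fun n : ℕ => (eLpNorm (row H (1 / ((n : ℝ) + 1))) 2 volume).toReal) atTop
      (𝓝 (eNorm H).toReal) := fun {H} hH =>
    (ENNReal.tendsto_toReal hH.2.ne).comp (tendsto_eLpNorm_row hH.1 hH.2)
  have t1 := t (hardySubmodule.add_mem hF hG)
  have t2 := t (hardySubmodule.sub_mem hF hG)
  refine tendsto_nhds_unique ((t1.mul t1).add (t2.mul t2)) ?_
  refine Tendsto.congr (fun n => (parallelogram_row hF hG (by positivity)).symm) ?_
  exact (((t hF).mul (t hF)).add ((t hG).mul (t hG))).const_mul 2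

/-- The mean value property, integrated over the radii. -/
lemma sq_enorm_le_lintegral_ball {f : ℂ → ℂ} {w : ℂ} {R : ℝ}
    (hf : DifferentiableOn ℂ f (Metric.ball w R)) :
    ‖f w‖ₑ ^ 2 * (∫⁻ r in Ioo 0 R, ENNReal.ofReal r) * ENNReal.ofReal (2 * Real.pi) ≤
      ∫⁻ v in Metric.ball w R, ‖f v‖ₑ ^ 2 := by
  classical
  set h : ℂ → ℝ≥0∞ := fun v => ‖(Metric.ball w R).piecewise f 0 v‖ₑ ^ 2 with hh
  have hmeas : Measurable h := by
    have : Measurable ((Metric.ball w R).piecewise f 0) :=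
      hf.continuousOn.measurable_piecewise continuousOn_const measurableSet_ball
    exact this.enorm.pow_const 2
  have e1 : ∫⁻ v in Metric.ball w R, ‖f v‖ₑ ^ 2 = ∫⁻ v, h v := by
    rw [← lintegral_indicator measurableSet_ball]
    refine lintegral_congr fun v => ?_
    by_cases hv : v ∈ Metric.ball w R
    · simp only [hh, indicator_of_mem hv, piecewise_eq_of_mem _ _ _ hv]
    · simp only [hh, indicator_of_notMem hv, piecewise_eq_of_notMem _ _ _ hv]; simp
  have e2 : ∫⁻ v, h v = ∫⁻ v, h (w + v) := (lintegral_add_left_eq_self h w).symm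
  have hm2 : Measurable fun v : ℂ => h (w + v) := hmeas.comp (measurable_const_add w)
  rw [e1, e2, ← Complex.lintegral_comp_polarCoord_symm]
  have etar : polarCoord.target = Ioi (0:ℝ) ×ˢ Ioo (-Real.pi) Real.pi := rfl
  have esymm : ∀ p : ℝ × ℝ, w + Complex.polarCoord.symm p = circleMap w p.1 p.2 := by
    intro p
    rw [Complex.polarCoord_symm_apply, circleMap, Complex.exp_mul_I, Complex.ofReal_cos, Complex.ofReal_sin]
  have hcm : Measurable fun p : ℝ × ℝ => circleMap w p.1 p.2 := by
    have : Continuous fun p : ℝ × ℝ => circleMap w p.1 p.2 := by unfold circleMap; fun_prop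
    exact this.measurable
  simp_rw [esymm]
  rw [etar, Measure.volume_eq_prod, ← Measure.prod_restrict, lintegral_prod _ (by
    exact ((measurable_fst.ennreal_ofReal).mul (hmeas.comp hcm)).aemeasurable)]
  have hcirc : ∀ r ∈ Ioo 0 R, ‖f w‖ₑ ^ 2 * ENNReal.ofReal r * ENNReal.ofReal (2 * Real.pi) ≤
      ∫⁻ θ in Ioo (-Real.pi) Real.pi, ENNReal.ofReal r • h (circleMap w r θ) := by
    intro r hr
    have hsub : Metric.closedBall w |r| ⊆ Metric.ball w R := by
      rw [abs_of_pos hr.1]; exact Metric.closedBall_subset_ball hr.2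
    have hd2 : DiffContOnCl ℂ (fun v => f v ^ 2) (Metric.ball w |r|) := by
      apply DifferentiableOn.diffContOnCl
      exact (hf.mono ((Metric.closure_ball_subset_closedBall).trans hsub)).pow 2
    have hav := hd2.circleAverage
    rw [Real.circleAverage_eq_integral_add (-Real.pi),
      intervalIntegral.integral_comp_add_right (fun θ => f (circleMap w r θ) ^ 2)] at hav
    have hav2 : ∫ θ in (-Real.pi)..Real.pi, f (circleMap w r θ) ^ 2 =
        (2 * Real.pi) • f w ^ 2 := by
      rw [← hav, smul_smul, mul_inv_cancel₀ (by positivity), one_smul]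
      congr 1 <;> ring
    have hb : ENNReal.ofReal (2 * Real.pi) * ‖f w‖ₑ ^ 2 ≤
        ∫⁻ θ in Ioo (-Real.pi) Real.pi, h (circleMap w r θ) := by
      calc ENNReal.ofReal (2 * Real.pi) * ‖f w‖ₑ ^ 2 = ‖(2 * Real.pi) • f w ^ 2‖ₑ := by
            rw [enorm_smul, enorm_pow, Real.enorm_of_nonneg (by positivity)]
        _ = ‖∫ θ in Ioc (-Real.pi) Real.pi, f (circleMap w r θ) ^ 2‖ₑ := by
            rw [← hav2, intervalIntegral.integral_of_le (by linarith [Real.pi_pos])]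
        _ ≤ ∫⁻ θ in Ioc (-Real.pi) Real.pi, ‖f (circleMap w r θ) ^ 2‖ₑ :=
            enorm_integral_le_lintegral_enorm _
        _ = ∫⁻ θ in Ioo (-Real.pi) Real.pi, ‖f (circleMap w r θ) ^ 2‖ₑ :=
            setLIntegral_congr Ioo_ae_eq_Ioc.symm
        _ = _ := by
            refine lintegral_congr fun θ => ?_
            have hm : circleMap w r θ ∈ Metric.ball w R :=
              hsub (by rw [abs_of_pos hr.1]; exact circleMap_mem_closedBall w hr.1.le θ)
            simp only [hh, piecewise_eq_of_mem _ _ _ hm, enorm_pow]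
    simp_rw [smul_eq_mul]
    rw [lintegral_const_mul' _ _ ENNReal.ofReal_ne_top]
    calc _ = ENNReal.ofReal r * (ENNReal.ofReal (2 * Real.pi) * ‖f w‖ₑ ^ 2) := by ring
      _ ≤ _ := mul_le_mul_right hb _
  calc _ = ∫⁻ r in Ioo 0 R, ‖f w‖ₑ ^ 2 * ENNReal.ofReal r * ENNReal.ofReal (2 * Real.pi) := by
        rw [lintegral_mul_const' _ _ ENNReal.ofReal_ne_top, lintegral_const_mul' _ _ (by
          exact (ENNReal.pow_lt_top enorm_lt_top).ne)]
    _ ≤ ∫⁻ r in Ioo 0 R, ∫⁻ θ in Ioo (-Real.pi) Real.pi,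
          ENNReal.ofReal r • h (circleMap w r θ) :=
        setLIntegral_mono' measurableSet_Ioo hcirc
    _ ≤ _ := lintegral_mono_set Ioo_subset_Ioi_self

lemma lintegral_strip_le {F : ℍ → ℂ} (hF : IsAnalytic F) {a b : ℝ} (ha : 0 < a) :
    ∫⁻ v in Complex.im ⁻¹' Ioo a b, ‖(F ∘ UpperHalfPlane.ofComplex) v‖ₑ ^ 2 ≤
      ENNReal.ofReal (b - a) * eNorm F ^ 2 := by
  set f : ℂ → ℂ := F ∘ UpperHalfPlane.ofComplex with hfdef
  set S : Set ℂ := Complex.im ⁻¹' Ioo a b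
  have hSo : IsOpen S := isOpen_Ioo.preimage Complex.continuous_im
  have hS : MeasurableSet S := hSo.measurableSet
  classical
  set h : ℂ → ℝ≥0∞ := fun v => ‖S.piecewise f 0 v‖ₑ ^ 2 with hh
  have hmeas : Measurable h := by
    have : Measurable (S.piecewise f 0) :=
      (hF.continuousOn.mono fun v (hv : v.im ∈ Ioo a b) => ha.trans hv.1).measurable_piecewise
        continuousOn_const hS
    exact this.enorm.pow_const 2
  have e1 : ∫⁻ v in S, ‖f v‖ₑ ^ 2 = ∫⁻ v, h v := by
    rw [← lintegral_indicator hS]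
    refine lintegral_congr fun v => ?_
    by_cases hv : v ∈ S
    · simp only [hh, indicator_of_mem hv, piecewise_eq_of_mem _ _ _ hv]
    · simp only [hh, indicator_of_notMem hv, piecewise_eq_of_notMem _ _ _ hv]; simp
  have e2 : ∫⁻ v, h v = ∫⁻ p : ℝ × ℝ, h (Complex.measurableEquivRealProd.symm p) :=
    (Complex.volume_preserving_equiv_real_prod.symm.lintegral_comp hmeas).symm
  rw [e1, e2, Measure.volume_eq_prod, lintegral_prod_symm _
    (show AEMeasurable (fun p : ℝ × ℝ => h (Complex.measurableEquivRealProd.symm p)) _ from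
      (hmeas.comp Complex.measurableEquivRealProd.symm.measurable).aemeasurable)]
  have hrow : ∀ y : ℝ, ∫⁻ x : ℝ, h (Complex.measurableEquivRealProd.symm (x, y)) ≤
      (Ioo a b).indicator (fun _ => eNorm F ^ 2) y := by
    intro y
    by_cases hy : y ∈ Ioo a b
    · have hy0 : 0 < y := ha.trans hy.1
      rw [indicator_of_mem hy]
      have : ∀ x : ℝ, h (Complex.measurableEquivRealProd.symm (x, y)) = ‖row F y x‖ₑ ^ 2 := by
        intro x
        have e : Complex.measurableEquivRealProd.symm (x, y) = (x:ℂ) + y * Complex.I := by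
          apply Complex.ext <;> simp [Complex.measurableEquivRealProd]
        have hm : (x:ℂ) + y * Complex.I ∈ S := by
          show ((x:ℂ) + y * Complex.I).im ∈ Ioo a b
          simpa using hy
        rw [e]
        simp only [hh, piecewise_eq_of_mem _ _ _ hm]
        rfl
      simp_rw [this]
      have h2 := eLpNorm_nnreal_pow_eq_lintegral (f := row F y) (μ := volume) (p := 2) (by norm_num)
      have h3 : ((2 : NNReal) : ℝ≥0∞) = 2 := rfl
      have h4 : ((2 : NNReal) : ℝ) = ((2:ℕ):ℝ) := by norm_num
      rw [h3, h4] at h2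
      simp_rw [ENNReal.rpow_natCast] at h2
      rw [← h2]
      exact pow_le_pow_left₀ bot_le (row_le_eNorm F hy0) 2
    · have : ∀ x : ℝ, h (Complex.measurableEquivRealProd.symm (x, y)) = 0 := by
        intro x
        have hm : Complex.measurableEquivRealProd.symm (x, y) ∉ S := by
          show ¬ (_ ∈ Ioo a b)
          simpa [Complex.measurableEquivRealProd] using hy
        simp only [hh, piecewise_eq_of_notMem _ _ _ hm]
        simp
      simp_rw [this]
      simp
  refine (lintegral_mono hrow).trans ?_
  rw [lintegral_indicator measurableSet_Ioo, setLIntegral_const, Real.volume_Ioo, mul_comm]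

/-- Point evaluations are bounded, uniformly on `{Im z > 2 R}`. -/
lemma exists_enorm_le {R : ℝ} (hR : 0 < R) : ∃ C : ℝ≥0∞, C < ∞ ∧ ∀ F : ℍ → ℂ, IsAnalytic F →
    ∀ z : ℍ, 2 * R < z.im → ‖F z‖ₑ ≤ C * eNorm F := by
  set c : ℝ≥0∞ := (∫⁻ r in Ioo 0 R, ENNReal.ofReal r) * ENNReal.ofReal (2 * Real.pi) with hc
  have hi : (∫⁻ r in Ioo 0 R, ENNReal.ofReal r) ≠ 0 := by
    have hlow : ∫⁻ r in Ioo (R/2) R, ENNReal.ofReal (R/2) ≤ ∫⁻ r in Ioo 0 R, ENNReal.ofReal r :=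
      (setLIntegral_mono' measurableSet_Ioo fun r hr => ENNReal.ofReal_le_ofReal hr.1.le).trans
        (lintegral_mono_set (Ioo_subset_Ioo_left (by linarith)))
    rw [setLIntegral_const, Real.volume_Ioo] at hlow
    refine ((ENNReal.mul_pos ?_ ?_).trans_le hlow).ne'
    · simp; linarith
    · simp; linarith
  have hc0 : c ≠ 0 := mul_ne_zero hi (by simp [Real.pi_pos])
  refine ⟨((ENNReal.ofReal (2 * R)) / c) ^ (1/2 : ℝ), ?_, fun F hF z hz => ?_⟩
  · exact ENNReal.rpow_lt_top_of_nonneg (by norm_num)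
      (ENNReal.div_lt_top ENNReal.ofReal_ne_top hc0).ne
  · have hzim : (z : ℂ).im = z.im := rfl
    have him : ∀ v ∈ Metric.ball (z:ℂ) R, v.im ∈ Ioo (z.im - R) (z.im + R) := by
      intro v hv
      have h1 : |v.im - z.im| < R := by
        have := Complex.abs_im_le_norm (v - z)
        rw [Complex.sub_im, hzim] at this
        exact this.trans_lt (by simpa [dist_eq_norm] using hv)
      rw [abs_lt] at h1
      constructor <;> linarith [h1.1, h1.2]
    have h1 := sq_enorm_le_lintegral_ball (f := F ∘ UpperHalfPlane.ofComplex) (w := z) (R := R)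
      (hF.mono fun v hv => by
        have := (him v hv).1
        show 0 < v.im
        linarith)
    have h2 := (lintegral_mono_set (μ := volume)
      (f := fun v => ‖(F ∘ UpperHalfPlane.ofComplex) v‖ₑ ^ 2)
      (fun v hv => him v hv : Metric.ball (z:ℂ) R ⊆ Complex.im ⁻¹' Ioo (z.im - R) (z.im + R)))
    have h3 := h1.trans (h2.trans (lintegral_strip_le hF (by linarith)))
    have e : z.im + R - (z.im - R) = 2 * R := by ring
    rw [e, mul_assoc, ← hc, Function.comp_apply, UpperHalfPlane.ofComplex_apply] at h3
    have hctop : c ≠ ∞ ∨ ENNReal.ofReal (2 * R) * eNorm F ^ 2 ≠ ∞ := by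
      left
      refine ENNReal.mul_ne_top ?_ ENNReal.ofReal_ne_top
      have : ∫⁻ r in Ioo 0 R, ENNReal.ofReal r ≤ ∫⁻ r in Ioo 0 R, ENNReal.ofReal R :=
        setLIntegral_mono' measurableSet_Ioo fun r hr => ENNReal.ofReal_le_ofReal hr.2.le
      rw [setLIntegral_const] at this
      exact (this.trans_lt (ENNReal.mul_lt_top ENNReal.ofReal_lt_top (by simp))).ne
    have h4 := (ENNReal.le_div_iff_mul_le (Or.inl hc0) hctop).2 h3
    have h5 : ENNReal.ofReal (2 * R) * eNorm F ^ 2 / c =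
        (((ENNReal.ofReal (2 * R)) / c) ^ (1/2 : ℝ) * eNorm F) ^ 2 := by
      rw [mul_pow, ← ENNReal.rpow_natCast (_ ^ (1/2:ℝ)), ← ENNReal.rpow_mul]
      have e12 : (1 / 2 : ℝ) * ((2 : ℕ) : ℝ) = 1 := by norm_num
      rw [e12, ENNReal.rpow_one, ENNReal.div_eq_inv_mul, ENNReal.div_eq_inv_mul, mul_assoc]
    rw [h5] at h4
    exact (ENNReal.pow_le_pow_left_iff two_ne_zero).1 h4

end

end HalfPlaneHardy

open HalfPlaneHardy

noncomputable section

/-- The Hardy space `H²(ℂ⁺)`: the analytic functions `F` on the upper half-plane `ℂ⁺ = ℍ` with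
`‖F‖ = sup_{y > 0} (∫ |F(x + iy)|² dx)^{1/2} < ∞`. -/
def HardyH2 : Type := hardySubmodule

namespace HardyH2

instance : AddCommGroup HardyH2 := inferInstanceAs (AddCommGroup hardySubmodule)

instance : Module ℂ HardyH2 := inferInstanceAs (Module ℂ hardySubmodule)

instance : CoeFun HardyH2 (fun _ => ℍ → ℂ) := ⟨fun f => f.1⟩

lemma ext {f g : HardyH2} (h : ∀ z, f z = g z) : f = g := Subtype.ext (funext h)

instance : Norm HardyH2 := ⟨fun f => (eNorm f).toReal⟩

lemma norm_def (f : HardyH2) : ‖f‖ = (eNorm f).toReal := rfl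

instance : NormedAddCommGroup HardyH2 :=
  AddGroupNorm.toNormedAddCommGroup
    { toFun := fun f => ‖f‖
      map_zero' := by
        show (eNorm 0).toReal = 0
        rw [eNorm_zero]; rfl
      add_le' := fun f g => by
        show (eNorm (f.1 + g.1)).toReal ≤ (eNorm f.1).toReal + (eNorm g.1).toReal
        rw [← ENNReal.toReal_add f.2.2.ne g.2.2.ne]
        exact ENNReal.toReal_mono (ENNReal.add_lt_top.2 ⟨f.2.2, g.2.2⟩).ne
          (eNorm_add_le f.2.1 g.2.1)
      neg' := fun f => by
        show (eNorm (-f.1)).toReal = (eNorm f.1).toReal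
        rw [eNorm_neg]
      eq_zero_of_map_eq_zero' := fun f hf => by
        have h : (eNorm f.1).toReal = 0 := hf
        rcases (ENNReal.toReal_eq_zero_iff _).1 h with h | h
        · exact Subtype.ext (eNorm_eq_zero f.2.1 h)
        · exact absurd h f.2.2.ne }

instance : NormedSpace ℂ HardyH2 where
  norm_smul_le c f := by
    show (eNorm (c • f.1)).toReal ≤ ‖c‖ * (eNorm f.1).toReal
    rw [eNorm_smul, ENNReal.toReal_mul]
    simp

/-- The inner product (linear in the second variable) that induces the norm by polarization. -/
instance : InnerProductSpace ℂ HardyH2 :=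
  InnerProductSpace.ofNorm ℂ fun f g => parallelogram_eNorm f.2 g.2

lemma norm_apply_le {R : ℝ} (hR : 0 < R) : ∃ C : ℝ, 0 ≤ C ∧ ∀ f : HardyH2, ∀ z : ℍ, 2 * R < z.im →
    ‖f z‖ ≤ C * ‖f‖ := by
  obtain ⟨C, hC, h⟩ := exists_enorm_le hR
  refine ⟨C.toReal, ENNReal.toReal_nonneg, fun f z hz => ?_⟩
  have := ENNReal.toReal_mono (ENNReal.mul_lt_top hC f.2.2).ne (h f.1 f.2.1 z hz)
  rwa [ENNReal.toReal_mul, toReal_enorm] at this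

instance : CompleteSpace HardyH2 := by
  refine Metric.complete_of_cauchySeq_tendsto fun u hu => ?_
  have hunif : ∀ R : ℝ, 0 < R → UniformCauchySeqOn (fun n (z : ℍ) => u n z) atTop
      {z | 2 * R < z.im} := by
    intro R hR
    obtain ⟨C, hC, h⟩ := norm_apply_le hR
    rw [Metric.uniformCauchySeqOn_iff]
    intro ε hε
    obtain ⟨N, hN⟩ := Metric.cauchySeq_iff.1 hu (ε / (C + 1)) (by positivity)
    refine ⟨N, fun m hm n hn z hz => ?_⟩
    have h1 := h (u m - u n) z hz
    have h2 := hN m hm n hn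
    rw [dist_eq_norm] at h2 ⊢
    have h3 : ((u m - u n : HardyH2) : ℍ → ℂ) z = u m z - u n z := rfl
    rw [h3] at h1
    refine h1.trans_lt ?_
    calc C * ‖u m - u n‖ ≤ (C + 1) * ‖u m - u n‖ := by gcongr; linarith
      _ < (C + 1) * (ε / (C + 1)) := by gcongr
      _ = ε := by field_simp
  have hpt : ∀ z : ℍ, ∃ c, Tendsto (fun n => u n z) atTop (𝓝 c) := by
    intro z
    have h := (hunif (z.im / 3) (by have := z.im_pos; positivity)).cauchySeq (x := z)
      (by have := z.im_pos; show 2 * (z.im / 3) < z.im; linarith)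
    exact cauchySeq_tendsto_of_complete h
  choose F hF using hpt
  have hFan : IsAnalytic F := by
    intro w hw
    have hw' : 0 < w.im := hw
    set V : Set ℂ := {v : ℂ | 2 * (w.im / 3) < v.im} with hV
    have hVo : IsOpen V := isOpen_lt continuous_const Complex.continuous_im
    have hVsub : V ⊆ {v : ℂ | 0 < v.im} := fun v (hv : 2 * (w.im / 3) < v.im) => by
      show 0 < v.im; linarith
    have hwV : w ∈ V := by show 2 * (w.im / 3) < w.im; linarith
    have ht : TendstoUniformlyOn (fun n (z : ℍ) => u n z) F atTop {z | 2 * (w.im / 3) < z.im} :=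
      (hunif (w.im / 3) (by positivity)).tendstoUniformlyOn_of_tendsto fun z _ => hF z
    have ht2 : TendstoUniformlyOn (fun n (v : ℂ) => ((u n : ℍ → ℂ) ∘ UpperHalfPlane.ofComplex) v)
        (F ∘ UpperHalfPlane.ofComplex) atTop V := by
      refine (ht.comp UpperHalfPlane.ofComplex).mono fun v hv => ?_
      show 2 * (w.im / 3) < (UpperHalfPlane.ofComplex v).im
      rw [UpperHalfPlane.ofComplex_apply_of_im_pos (hVsub hv)]
      exact hv
    have hd := ht2.tendstoLocallyUniformlyOn.differentiableOn
      (Eventually.of_forall fun n => (u n).2.1.mono hVsub) hVo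
    exact ((hd w hwV).differentiableAt (hVo.mem_nhds hwV)).differentiableWithinAt
  have hclose : ∀ ε : ℝ, 0 < ε → ∃ N, ∀ n ≥ N, eNorm ((u n).1 - F) ≤ ENNReal.ofReal ε := by
    intro ε hε
    obtain ⟨N, hN⟩ := Metric.cauchySeq_iff.1 hu ε hε
    refine ⟨N, fun n hn => iSup₂_le fun y hy => ?_⟩
    have hlim := Lp.eLpNorm_lim_le_liminf_eLpNorm (p := 2) (μ := (volume : Measure ℝ))
      (f := fun m : ℕ => row ((u n).1 - (u m).1) y)
      (fun m => (hardySubmodule.sub_mem (u n).2 (u m).2).1.aesm_row hy _)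
      (row ((u n).1 - F) y) (Eventually.of_forall fun x => tendsto_const_nhds.sub (hF _))
    refine hlim.trans (liminf_le_of_le (by isBoundedDefault) fun b hb => ?_)
    obtain ⟨m, hm1, hm2⟩ := (hb.and (eventually_ge_atTop N)).exists
    refine hm1.trans ((row_le_eNorm _ hy).trans ?_)
    have h2 := (hN n hn m hm2).le
    rw [dist_eq_norm] at h2
    have h3 : (eNorm ((u n).1 - (u m).1)).toReal ≤ ε := h2
    exact (ENNReal.le_ofReal_iff_toReal_le
      (hardySubmodule.sub_mem (u n).2 (u m).2).2.ne hε.le).2 h3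
  have hmem : F ∈ hardySubmodule := by
    obtain ⟨N, hN⟩ := hclose 1 one_pos
    have h1 : (u N).1 - F ∈ hardySubmodule :=
      ⟨(u N).2.1.sub hFan, (hN N le_rfl).trans_lt ENNReal.ofReal_lt_top⟩
    have := hardySubmodule.sub_mem (u N).2 h1
    simpa using this
  let G : HardyH2 := (⟨F, hmem⟩ : hardySubmodule)
  refine ⟨G, ?_⟩
  rw [Metric.tendsto_atTop]
  intro ε hε
  obtain ⟨N, hN⟩ := hclose (ε / 2) (by positivity)
  refine ⟨N, fun n hn => ?_⟩
  rw [dist_eq_norm]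
  have h1 : ‖u n - G‖ ≤ ε / 2 := by
    show (eNorm ((u n).1 - F)).toReal ≤ ε / 2
    exact ENNReal.toReal_le_of_le_ofReal (by positivity) (hN n hn)
  linarith

end HardyH2

/-- The value at `z` of a rational function (`0` at its poles). -/
def ratEval (φ : RatFunc ℂ) (z : ℂ) : ℂ := φ.eval (RingHom.id ℂ) z

/-- The rational function `s ↦ conj (φ (conj s))`. -/
def conjSymbol (φ : RatFunc ℂ) (s : ℂ) : ℂ := conj (ratEval φ (conj s))

/-- The points `t` of the upper half-plane with `conj (φ (conj t)) = z`. As `z ≠ 0`, the value `0`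
that `ratEval` takes at poles adds no points. -/
def conjFiber (φ : RatFunc ℂ) (z : ℍ) : Set ℍ := {t : ℍ | conjSymbol φ t = z}

/-- The residue at `t` of a function with an isolated singularity at `t`: the common value of
`(2πi)⁻¹ ∮ g(s) ds` over all sufficiently small positively oriented circles around `t`. -/
def complexResidue (g : ℂ → ℂ) (t : ℂ) : ℂ :=
  limUnder (𝓝[>] (0 : ℝ)) fun r => (2 * Real.pi * Complex.I)⁻¹ * ∮ s in C(t, r), g s

/-- All poles of `s ↦ 1 / (conj (φ (conj s)) - z)` in the upper half-plane are simple. -/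
def HasSimplePoles (φ : RatFunc ℂ) (z : ℍ) : Prop :=
  ∀ t ∈ conjFiber φ z, meromorphicOrderAt (fun s : ℂ => 1 / (conjSymbol φ s - z)) t = -1

end

/-! Write ψ(s) = conj(φ(conj s)) and let k_w(s) = i / (2π(s - conj w)) be the reproducing kernel of
H². Evaluating the adjoint at z means pairing with k_z: (C_φ* f)(z) = ⟨k_z, C_φ* f⟩ = ⟨C_φ k_z, f⟩.
So it suffices to show that the residue sum ρ(f) = Σ Res(f/(ψ - z)) is a bounded functional on H²
and that C_φ k_z is its Riesz representative. Representatives can be compared pointwise, by testing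
on kernels: the claim becomes ρ(k_w) = conj(k_z(φ(w))) for all w.

This last identity is a residue computation for rational functions. Since φ(∞) = ∞, the function
1/(ψ - z) is O(1/|s|), so k_w/(ψ - z) is O(1/|s|²) and its residues over the whole plane add up to
zero. Its poles are conj w and the solutions of ψ = z. The latter all lie in the upper half-plane,
because ψ maps the lower half-plane into itself. Hence the sum over S_z is minus the residue at conj
w, where ψ(conj w) = conj(φ(w)). The lemmas are `sum_circleIntegral_rational`, `im_pos_of_root` and
`adjoint_apply_eq_finsum_residue`.

Two analytic facts are needed. Boundedness of C_φ follows from a Poisson majorant for |F|² together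
with `lintegral_poissonKer_le`, where the linear growth of φ at infinity bounds the integral over x
of the Poisson kernel at φ(x + iy). The reproducing property `inner_kernel` is Cauchy's formula on
horizontal lines.

Multiple poles occur only when z is a critical value of ψ, and ψ has finitely many critical points.
-/

namespace HalfPlaneHardy

/-! ### The Poisson formula on the half-plane -/

/-- The Poisson kernel of the upper half-plane. -/
noncomputable def poissonKer (u : ℂ) (x : ℝ) : ℝ := u.im / Real.pi / ‖(x : ℂ) - u‖ ^ 2

lemma norm_ofReal_sub_sq (u : ℂ) (x : ℝ) : ‖(x : ℂ) - u‖ ^ 2 = (x - u.re) ^ 2 + u.im ^ 2 := by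
  rw [← Complex.normSq_eq_norm_sq, Complex.normSq_apply]
  simp; ring

lemma ofReal_sub_ne_zero {u : ℂ} (hu : u.im ≠ 0) (x : ℝ) : (x : ℂ) - u ≠ 0 := by
  intro h
  have := congrArg Complex.im h
  simp at this
  exact hu this

lemma ofReal_sub_mul_conj (u : ℂ) (x : ℝ) :
    ((x : ℂ) - u) * ((x : ℂ) - conj u) = ((‖(x : ℂ) - u‖ ^ 2 : ℝ) : ℂ) := by
  rw [← Complex.normSq_eq_norm_sq, ← Complex.mul_conj]
  simp

lemma poissonKer_nonneg {u : ℂ} (hu : 0 ≤ u.im) (x : ℝ) : 0 ≤ poissonKer u x := by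
  unfold poissonKer; positivity

lemma continuous_inv_norm_sq {u : ℂ} (hu : u.im ≠ 0) :
    Continuous fun x : ℝ => (‖(x : ℂ) - u‖ ^ 2)⁻¹ := by
  refine Continuous.inv₀ (by fun_prop) fun x => ?_
  have := norm_pos_iff.2 (ofReal_sub_ne_zero hu x)
  positivity

lemma inv_norm_sq_eq {u : ℂ} (hu : u.im ≠ 0) (x : ℝ) :
    (‖(x : ℂ) - u‖ ^ 2)⁻¹ = (u.im ^ 2)⁻¹ * (1 + (u.im⁻¹ * (x - u.re)) ^ 2)⁻¹ := by
  rw [norm_ofReal_sub_sq, ← mul_inv]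
  congr 1
  field_simp
  ring

lemma integrable_inv_norm_sq {u : ℂ} (hu : u.im ≠ 0) :
    Integrable fun x : ℝ => (‖(x : ℂ) - u‖ ^ 2)⁻¹ := by
  simp_rw [inv_norm_sq_eq hu]
  refine Integrable.const_mul ?_ _
  have h := (integrable_inv_one_add_sq.comp_mul_left' (inv_ne_zero hu))
  exact h.comp_sub_right u.re

lemma integral_inv_norm_sq {u : ℂ} (hu : 0 < u.im) :
    ∫ x : ℝ, (‖(x : ℂ) - u‖ ^ 2)⁻¹ = Real.pi / u.im := by
  simp_rw [inv_norm_sq_eq hu.ne']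
  rw [integral_const_mul,
    integral_sub_right_eq_self (fun x : ℝ => (1 + (u.im⁻¹ * x) ^ 2)⁻¹) u.re,
    Measure.integral_comp_mul_left (fun x : ℝ => (1 + x ^ 2)⁻¹) u.im⁻¹,
    integral_univ_inv_one_add_sq, inv_inv, abs_of_pos hu, smul_eq_mul]
  field_simp

lemma continuousOn_ofReal_row {g : ℂ → ℂ} (hg : DifferentiableOn ℂ g {z | 0 ≤ z.im}) :
    Continuous fun x : ℝ => g x :=
  hg.continuousOn.comp_continuous (by fun_prop) (fun x => by simp)

/-- Cauchy's theorem for the half-plane, for functions that are `O(|s|⁻²)`. -/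
lemma integral_real_line_eq_zero {g : ℂ → ℂ} (hg : DifferentiableOn ℂ g {z | 0 ≤ z.im})
    {C R₀ : ℝ} (hC : 0 ≤ C) (hb : ∀ s : ℂ, 0 ≤ s.im → R₀ ≤ ‖s‖ → ‖g s‖ ≤ C / ‖s‖ ^ 2)
    (hint : Integrable fun x : ℝ => g x) : ∫ x : ℝ, g x = 0 := by
  have hlim := intervalIntegral_tendsto_integral hint tendsto_neg_atTop_atBot tendsto_id
  refine tendsto_nhds_unique hlim ?_
  -- The other three sides of the rectangle [-R, R] × [0, R] have total length 4R, and |g| ≤ C/R² on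
  -- them.
  refine squeeze_zero_norm' (a := fun R : ℝ => 4 * C / R) ?_
    (tendsto_const_nhds.div_atTop tendsto_id)
  filter_upwards [eventually_ge_atTop R₀, eventually_gt_atTop 0] with R hR hR0
  have hrect := Complex.integral_boundary_rect_eq_zero_of_differentiableOn g (-R : ℂ)
    (R + R * Complex.I) (hg.mono ?_)
  swap
  · rintro z ⟨_, hz2⟩
    simp only [Complex.neg_im, Complex.ofReal_im, neg_zero, Complex.add_im, Complex.mul_im,
      Complex.ofReal_re, Complex.I_im, mul_one, Complex.I_re, mul_zero, zero_add, add_zero,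
      mem_preimage, uIcc_of_le hR0.le] at hz2
    exact hz2.1
  simp only [Complex.neg_im, Complex.ofReal_im, neg_zero, Complex.add_im, Complex.mul_im,
      Complex.ofReal_re, Complex.I_im, mul_one, Complex.I_re, mul_zero, zero_add, add_zero,
      Complex.neg_re, Complex.add_re, Complex.mul_re, Complex.ofReal_zero, zero_mul,
      sub_self, Complex.ofReal_neg] at hrect
  have hside : ∀ s : ℂ, 0 ≤ s.im → R ≤ ‖s‖ → ‖g s‖ ≤ C / R ^ 2 := by
    intro s hs hsR
    refine (hb s hs (hR.trans hsR)).trans ?_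
    gcongr
  have h1 : ‖∫ x : ℝ in -R..R, g (x + R * Complex.I)‖ ≤ C / R ^ 2 * |R - -R| := by
    refine intervalIntegral.norm_integral_le_of_norm_le_const fun x _ => hside _ (by simp [hR0.le]) ?_
    have := Complex.abs_im_le_norm ((x : ℂ) + R * Complex.I)
    simpa [abs_of_pos hR0] using this
  have h2 : ‖∫ y : ℝ in (0:ℝ)..R, g (R + y * Complex.I)‖ ≤ C / R ^ 2 * |R - 0| := by
    refine intervalIntegral.norm_integral_le_of_norm_le_const fun y hy => hside _ ?_ ?_
    · rw [uIoc_of_le hR0.le] at hy; simpa using hy.1.le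
    · have := Complex.abs_re_le_norm ((R : ℂ) + y * Complex.I)
      simpa [abs_of_pos hR0] using this
  have h3 : ‖∫ y : ℝ in (0:ℝ)..R, g (-R + y * Complex.I)‖ ≤ C / R ^ 2 * |R - 0| := by
    refine intervalIntegral.norm_integral_le_of_norm_le_const fun y hy => hside _ ?_ ?_
    · rw [uIoc_of_le hR0.le] at hy; simpa using hy.1.le
    · have := Complex.abs_re_le_norm (-(R : ℂ) + y * Complex.I)
      simpa [abs_of_pos hR0] using this
  have e : (∫ x : ℝ in -R..R, g x) = (∫ x : ℝ in -R..R, g (x + R * Complex.I))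
      - Complex.I • (∫ y : ℝ in (0:ℝ)..R, g (R + y * Complex.I))
      + Complex.I • (∫ y : ℝ in (0:ℝ)..R, g (-R + y * Complex.I)) := by
    linear_combination hrect
  simp only [id]
  rw [e]
  refine (norm_add_le _ _).trans ((add_le_add (norm_sub_le _ _) le_rfl).trans ?_)
  rw [norm_smul, norm_smul, Complex.norm_I, one_mul, one_mul]
  refine (add_le_add (add_le_add h1 h2) h3).trans (le_of_eq ?_)
  rw [sub_neg_eq_add, sub_zero, abs_of_pos hR0, abs_of_pos (by linarith)]
  field_simp
  ring

lemma half_norm_le_norm_sub {s u : ℂ} (h : 2 * ‖u‖ ≤ ‖s‖) : ‖s‖ / 2 ≤ ‖s - u‖ := by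
  have := norm_sub_norm_le s u
  linarith

/-- The Poisson formula for bounded analytic functions on the closed half-plane. -/
lemma poisson_formula {F : ℂ → ℂ} (hF : DifferentiableOn ℂ F {z | 0 ≤ z.im}) {M : ℝ}
    (hM : ∀ s : ℂ, 0 ≤ s.im → ‖F s‖ ≤ M) {u : ℂ} (hu : 0 < u.im) :
    ∫ x : ℝ, (poissonKer u x : ℂ) * F x = F u := by
  have hM0 : 0 ≤ M := (norm_nonneg _).trans (hM u hu.le)
  -- The difference quotient of F at u divided by s - conj u has no pole in the closed half-plane,
  -- and on the real line it equals (F x - F u)/|x - u|². Its integral vanishes by Cauchy's theorem,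
  -- which leaves F u times the mass of the kernel.
  set g : ℂ → ℂ := fun s => dslope F u s * (s - conj u)⁻¹ with hgdef
  have hnhds : {z : ℂ | 0 ≤ z.im} ∈ 𝓝 u :=
    mem_of_superset (isOpen_im_pos.mem_nhds hu) fun z (hz : 0 < z.im) => hz.le
  have hne : ∀ s : ℂ, 0 ≤ s.im → s - conj u ≠ 0 := by
    intro s hs h
    have := congrArg Complex.im h
    simp at this
    linarith
  have hg : DifferentiableOn ℂ g {z | 0 ≤ z.im} :=
    ((Complex.differentiableOn_dslope hnhds).2 hF).mul
      ((differentiableOn_id.sub_const _).inv fun s hs => hne s hs)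
  have hgx : ∀ x : ℝ, g x = ((‖(x : ℂ) - u‖ ^ 2)⁻¹ : ℝ) * (F x - F u) := by
    intro x
    have hx := ofReal_sub_ne_zero hu.ne' x
    have hxu : (x : ℂ) ≠ u := sub_ne_zero.1 hx
    rw [hgdef]
    simp only
    rw [dslope_of_ne _ hxu, slope_def_field, Complex.ofReal_inv, ← ofReal_sub_mul_conj]
    field_simp
  have hint : Integrable fun x : ℝ => g x := by
    refine ((integrable_inv_norm_sq hu.ne').mul_const (2 * M)).mono'
      (continuousOn_ofReal_row hg).aestronglyMeasurable (Eventually.of_forall fun x => ?_)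
    rw [hgx, norm_mul, Complex.norm_real, Real.norm_of_nonneg (by positivity)]
    gcongr
    refine (norm_sub_le _ _).trans ?_
    linarith [hM x (by simp), hM u hu.le]
  have h0 : ∫ x : ℝ, g x = 0 := by
    -- For |s| ≥ 2|u| both s - u and s - conj u have modulus at least |s|/2, and |F s - F u| ≤ 2M;
    -- hence the constant 8M. The added 1 keeps s away from 0.
    refine integral_real_line_eq_zero hg (C := 8 * M) (R₀ := 2 * ‖u‖ + 1) (by positivity)
      (fun s hs hsR => ?_) hint
    have hu0 := norm_nonneg u
    have hs0 : 0 < ‖s‖ := by linarith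
    have hsu : s ≠ u := by rintro rfl; linarith
    have h1 : ‖s‖ / 2 ≤ ‖s - u‖ := half_norm_le_norm_sub (by linarith)
    have h2 : ‖s‖ / 2 ≤ ‖s - conj u‖ := half_norm_le_norm_sub (by
      rw [Complex.norm_conj]; linarith)
    simp only [hgdef]
    rw [dslope_of_ne _ hsu, slope_def_field, norm_mul, norm_div, norm_inv]
    have h3 : ‖F s - F u‖ ≤ 2 * M := (norm_sub_le _ _).trans (by linarith [hM s hs, hM u hu.le])
    calc _ ≤ 2 * M / (‖s‖ / 2) * (‖s‖ / 2)⁻¹ := by gcongr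
      _ = _ := by field_simp; ring
  have hiF : Integrable fun x : ℝ => (((‖(x : ℂ) - u‖ ^ 2)⁻¹ : ℝ) : ℂ) * F x := by
    refine ((integrable_inv_norm_sq hu.ne').mul_const M).mono'
      ((Complex.continuous_ofReal.comp (continuous_inv_norm_sq hu.ne')).mul
        (continuousOn_ofReal_row hF)).aestronglyMeasurable (Eventually.of_forall fun x => ?_)
    rw [norm_mul, Complex.norm_real, Real.norm_of_nonneg (by positivity)]
    gcongr
    exact hM x (by simp)
  have hic : Integrable fun x : ℝ => (((‖(x : ℂ) - u‖ ^ 2)⁻¹ : ℝ) : ℂ) * F u :=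
    (integrable_inv_norm_sq hu.ne').ofReal.mul_const _
  simp_rw [hgx, mul_sub] at h0
  rw [integral_sub hiF hic, integral_mul_const, integral_complex_ofReal, integral_inv_norm_sq hu,
    sub_eq_zero] at h0
  have e : ∀ x : ℝ, (poissonKer u x : ℂ) * F x =
      ((u.im / Real.pi : ℝ) : ℂ) * ((((‖(x : ℂ) - u‖ ^ 2)⁻¹ : ℝ) : ℂ) * F x) := by
    intro x
    rw [poissonKer, div_eq_mul_inv (u.im / Real.pi), Complex.ofReal_mul, mul_assoc]
  simp_rw [e]
  rw [integral_const_mul, h0, ← mul_assoc, ← Complex.ofReal_mul]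
  have : u.im / Real.pi * (Real.pi / u.im) = 1 := by
    have := Real.pi_ne_zero
    field_simp
  rw [this]; simp

/-- F² is again analytic and bounded, so the Poisson formula for F² and the triangle inequality give
the bound without Jensen's inequality. -/
lemma sq_enorm_le_poisson {F : ℂ → ℂ} (hF : DifferentiableOn ℂ F {z | 0 ≤ z.im}) {M : ℝ}
    (hM : ∀ s : ℂ, 0 ≤ s.im → ‖F s‖ ≤ M) {u : ℂ} (hu : 0 < u.im) :
    ‖F u‖ₑ ^ 2 ≤ ∫⁻ x : ℝ, ENNReal.ofReal (poissonKer u x) * ‖F x‖ₑ ^ 2 := by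
  have h := poisson_formula (F := fun s => F s ^ 2) (hF.pow 2) (M := M ^ 2) (fun s hs => by
    rw [norm_pow]; gcongr; exact hM s hs) hu
  rw [← enorm_pow, ← h]
  refine (enorm_integral_le_lintegral_enorm _).trans (le_of_eq (lintegral_congr fun x => ?_))
  rw [enorm_mul, enorm_pow, ← ofReal_norm (poissonKer u x : ℂ), Complex.norm_real,
    Real.norm_of_nonneg (poissonKer_nonneg hu.le x)]

end HalfPlaneHardy

/-! ### Boundedness of the composition operator -/

namespace HalfPlaneHardy

lemma sq_eLpNorm_two (g : ℝ → ℂ) : eLpNorm g 2 volume ^ 2 = ∫⁻ x, ‖g x‖ₑ ^ 2 := by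
  have h2 := eLpNorm_nnreal_pow_eq_lintegral (f := g) (μ := volume) (p := 2) (by norm_num)
  have h3 : ((2 : NNReal) : ℝ≥0∞) = 2 := rfl
  have h4 : ((2 : NNReal) : ℝ) = ((2:ℕ):ℝ) := by norm_num
  rw [h3, h4] at h2
  simpa only [ENNReal.rpow_natCast] using h2

lemma measurable_poissonKer : Measurable fun p : ℂ × ℝ => poissonKer p.1 p.2 := by
  have h1 : Measurable fun p : ℂ × ℝ => ‖(p.2 : ℂ) - p.1‖ ^ 2 :=
    (Continuous.measurable (by fun_prop))
  exact ((Complex.measurable_im.comp measurable_fst).div_const _).div h1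

lemma continuous_poissonKer {u : ℂ} (hu : 0 < u.im) : Continuous (poissonKer u) :=
  continuous_const.mul (continuous_inv_norm_sq hu.ne')

lemma integrable_poissonKer {u : ℂ} (hu : 0 < u.im) : Integrable (poissonKer u) :=
  (integrable_inv_norm_sq hu.ne').const_mul _

lemma integrable_poissonKer_mul {u : ℂ} (hu : 0 < u.im) {g : ℝ → ℂ} (hg : Continuous g) {M : ℝ}
    (hM : ∀ x, ‖g x‖ ≤ M) : Integrable fun x => (poissonKer u x : ℂ) * g x := by
  refine ((integrable_poissonKer hu).mul_const M).mono'
    ((Complex.continuous_ofReal.comp (continuous_poissonKer hu)).mul hg).aestronglyMeasurable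
    (Eventually.of_forall fun x => ?_)
  rw [norm_mul, Complex.norm_real, Real.norm_of_nonneg (poissonKer_nonneg hu.le x)]
  exact mul_le_mul_of_nonneg_left (hM x) (poissonKer_nonneg hu.le x)

/-- Exhibits the Poisson kernel, as a function of its pole w, as the imaginary part of an analytic
function of w. After the substitution w = φ(s + iy) the Poisson formula can be applied once more,
now in s. -/
lemma im_neg_inv_sub (w : ℂ) (t : ℝ) : (-(w - t)⁻¹).im = Real.pi * poissonKer w t := by
  have := Real.pi_ne_zero
  rw [Complex.neg_im, Complex.inv_im, poissonKer, ← norm_neg ((t : ℂ) - w), neg_sub,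
    Complex.normSq_eq_norm_sq]
  simp
  field_simp

/-- A self-map of the half-plane that grows at least linearly has bounded Poisson averages. -/
lemma lintegral_poissonKer_le {φ : ℂ → ℂ} (hφ : DifferentiableOn ℂ φ {z | 0 < z.im})
    (hself : ∀ s : ℂ, 0 < s.im → 0 < (φ s).im) {c R₀ : ℝ} (hc : 0 < c)
    (hgrow : ∀ s : ℂ, 0 < s.im → R₀ ≤ ‖s‖ → c * ‖s‖ ≤ ‖φ s‖) {y : ℝ} (hy : 0 < y) (t : ℝ) :
    ∫⁻ x : ℝ, ENNReal.ofReal (poissonKer (φ (x + y * Complex.I)) t) ≤ ENNReal.ofReal (1 / c) := by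
  -- On the real line Im G(x) is π times the integrand. G is bounded: its denominator has no zero in
  -- the closed half-plane, and the linear growth of φ controls it near infinity.
  set G : ℂ → ℂ := fun s => -(φ (s + y * Complex.I) - t)⁻¹ with hGdef
  have him : ∀ s : ℂ, 0 ≤ s.im → 0 < (s + y * Complex.I).im := fun s hs => by
    simp; linarith
  have hne : ∀ s : ℂ, 0 ≤ s.im → φ (s + y * Complex.I) - t ≠ 0 := by
    intro s hs h
    have h1 := congrArg Complex.im h
    have h2 := hself _ (him s hs)
    simp only [Complex.sub_im, Complex.ofReal_im, sub_zero, Complex.zero_im] at h1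
    linarith
  have hG : DifferentiableOn ℂ G {z | 0 ≤ z.im} := by
    refine DifferentiableOn.neg (DifferentiableOn.inv (DifferentiableOn.sub_const ?_ _)
      fun s hs => hne s hs)
    exact hφ.comp (by fun_prop) fun s hs => him s hs
  have hlow : ∀ s : ℂ, 0 ≤ s.im → R₀ + y ≤ ‖s‖ →
      c * ‖s + y * Complex.I‖ - |t| ≤ ‖φ (s + y * Complex.I) - t‖ := by
    intro s hs hsR
    have h1 : ‖s‖ - y ≤ ‖s + y * Complex.I‖ := by
      have := norm_sub_norm_le s (-(y * Complex.I))
      simpa [abs_of_pos hy] using this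
    have h2 := hgrow _ (him s hs) (by linarith)
    have h3 := norm_sub_norm_le (φ (s + y * Complex.I)) t
    rw [Complex.norm_real, Real.norm_eq_abs] at h3
    linarith
  obtain ⟨M, hM⟩ : ∃ M : ℝ, ∀ s : ℂ, 0 ≤ s.im → ‖G s‖ ≤ M := by
    -- Beyond R₀ + y the growth estimate is available; beyond (1 + |t|)/c + y it forces |φ(s + iy) -
    -- t| ≥ 1.
    set ρ : ℝ := max (R₀ + y) ((1 + |t|) / c + y)
    have hK : IsCompact (Metric.closedBall (0:ℂ) ρ ∩ {z | 0 ≤ z.im}) :=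
      (isCompact_closedBall _ _).inter_right (isClosed_le continuous_const Complex.continuous_im)
    obtain ⟨M, hM⟩ := hK.exists_bound_of_continuousOn (hG.continuousOn.mono inter_subset_right)
    refine ⟨max M 1, fun s hs => ?_⟩
    by_cases h : ‖s‖ ≤ ρ
    · exact (hM s ⟨by simpa using h, hs⟩).trans (le_max_left _ _)
    · push Not at h
      have h0 := hlow s hs ((le_max_left _ _).trans h.le)
      have h1 : ‖s‖ - y ≤ ‖s + y * Complex.I‖ := by
        have := norm_sub_norm_le s (-(y * Complex.I))
        simpa [abs_of_pos hy] using this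
      have h2 : (1 + |t|) / c ≤ ‖s + y * Complex.I‖ := by
        have := (le_max_right (R₀ + y) ((1 + |t|) / c + y)).trans h.le
        linarith
      rw [div_le_iff₀' hc] at h2
      refine le_trans ?_ (le_max_right _ _)
      rw [hGdef]
      simp only
      rw [norm_neg, norm_inv]
      exact inv_le_one_of_one_le₀ (by linarith)
  have hGim : ∀ s : ℂ, (G s).im = Real.pi * poissonKer (φ (s + y * Complex.I)) t :=
    fun s => im_neg_inv_sub _ _
  have hpk : ∀ x : ℝ, 0 ≤ poissonKer (φ (x + y * Complex.I)) t := fun x =>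
    poissonKer_nonneg (hself _ (him x (by simp))).le t
  -- the Poisson formula at the point `i n`
  have hPn : ∀ n : ℕ, 0 < n → ∫⁻ x : ℝ, ENNReal.ofReal
      ((n ^ 2 / (x ^ 2 + n ^ 2)) * poissonKer (φ (x + y * Complex.I)) t) =
      ENNReal.ofReal (n * (G (n * Complex.I)).im) := by
    intro n hn
    have hn' : (0:ℝ) < n := by exact_mod_cast hn
    have hu : 0 < ((n : ℂ) * Complex.I).im := by simpa using hn'
    have hi := integrable_poissonKer_mul hu (continuousOn_ofReal_row hG)
      (M := M) (fun x => hM x (by simp))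
    have h1 := poisson_formula hG hM hu
    have h2 : ∀ x : ℝ, (n ^ 2 / (x ^ 2 + n ^ 2)) * poissonKer (φ (x + y * Complex.I)) t =
        n * (RCLike.im ((poissonKer (n * Complex.I) x : ℂ) * G x)) := by
      intro x
      have := Real.pi_ne_zero
      have h3 : 0 < x ^ 2 + (n:ℝ) ^ 2 := by positivity
      show _ = n * ((poissonKer (n * Complex.I) x : ℂ) * G x).im
      have h4 : poissonKer (n * Complex.I) x = n / Real.pi / (x ^ 2 + n ^ 2) := by
        rw [poissonKer, norm_ofReal_sub_sq]
        simp
      rw [Complex.im_ofReal_mul, hGim, h4]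
      field_simp
    simp_rw [h2]
    rw [← ofReal_integral_eq_lintegral_ofReal, integral_const_mul, integral_im hi, h1]
    · rfl
    · exact hi.im.const_mul _
    · refine Eventually.of_forall fun x => ?_
      simp only [Pi.zero_apply]
      rw [← h2]
      exact mul_nonneg (by positivity) (hpk x)
  -- The weights n²/(x² + n²) tend to 1, so Fatou's lemma bounds the unweighted integral by the
  -- liminf of n · Im G(in).
  have hfat := lintegral_liminf_le (u := atTop) (μ := (volume : Measure ℝ)) (f := fun (n : ℕ) (x : ℝ) =>
      ENNReal.ofReal ((n ^ 2 / (x ^ 2 + n ^ 2)) * poissonKer (φ (x + y * Complex.I)) t)) (by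
    intro n
    have hcφ : Continuous fun x : ℝ => φ (x + y * Complex.I) :=
      hφ.continuousOn.comp_continuous (by fun_prop) fun x => him x (by simp)
    have h := measurable_poissonKer.comp (hcφ.measurable.prodMk (measurable_const (a := t)))
    exact (Measurable.mul (by fun_prop) h).ennreal_ofReal)
  have e1 : ∀ x : ℝ, liminf (fun n : ℕ => ENNReal.ofReal
      ((n ^ 2 / (x ^ 2 + n ^ 2)) * poissonKer (φ (x + y * Complex.I)) t)) atTop =
      ENNReal.ofReal (poissonKer (φ (x + y * Complex.I)) t) := by
    intro x
    refine Tendsto.liminf_eq ?_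
    refine ENNReal.tendsto_ofReal ?_
    have h1 : Tendsto (fun n : ℕ => (1 + x ^ 2 * ((n : ℝ) ^ 2)⁻¹)⁻¹) atTop (𝓝 1) := by
      have h : Tendsto (fun n : ℕ => ((n : ℝ) ^ 2)⁻¹) atTop (𝓝 0) :=
        tendsto_inv_atTop_zero.comp
          ((tendsto_pow_atTop two_ne_zero).comp tendsto_natCast_atTop_atTop)
      have := ((h.const_mul (x ^ 2)).const_add 1).inv₀ (by simp)
      simpa using this
    have h2 := h1.mul_const (poissonKer (φ (x + y * Complex.I)) t)
    rw [one_mul] at h2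
    refine h2.congr' ?_
    filter_upwards [eventually_gt_atTop 0] with n hn
    have hn' : (0:ℝ) < n := by exact_mod_cast hn
    congr 1
    field_simp
    ring
  simp_rw [e1] at hfat
  refine hfat.trans ?_
  -- Linear growth gives n |G(in)| ≤ n/(cn - |t|), and this tends to 1/c for every t.
  have hlim : Tendsto (fun n : ℕ => ENNReal.ofReal ((c - |t| * (n : ℝ)⁻¹)⁻¹)) atTop
      (𝓝 (ENNReal.ofReal (1 / c))) := by
    refine ENNReal.tendsto_ofReal ?_
    have h : Tendsto (fun n : ℕ => (n : ℝ)⁻¹) atTop (𝓝 0) :=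
      tendsto_inv_atTop_zero.comp tendsto_natCast_atTop_atTop
    have := ((h.const_mul |t|).const_sub c).inv₀ (by simpa using hc.ne')
    simpa using this
  rw [← hlim.liminf_eq]
  refine liminf_le_liminf ?_
  filter_upwards [tendsto_natCast_atTop_atTop.eventually_ge_atTop (R₀ + y), eventually_gt_atTop 0,
    tendsto_natCast_atTop_atTop.eventually_gt_atTop (|t| / c)] with n hn hn0 hnt
  have hn' : (0:ℝ) < n := by exact_mod_cast hn0
  rw [hPn n hn0]
  refine ENNReal.ofReal_le_ofReal ?_
  rw [div_lt_iff₀ hc] at hnt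
  have h1 := hlow (n * Complex.I) (by simp) (by simpa using hn)
  have h2 : (n : ℝ) ≤ ‖(n : ℂ) * Complex.I + y * Complex.I‖ := by
    rw [← add_mul, norm_mul, Complex.norm_I, mul_one]
    have := Complex.re_le_norm ((n : ℂ) + y)
    simp at this
    linarith
  have h3 : c * n - |t| ≤ ‖φ (n * Complex.I + y * Complex.I) - t‖ := by nlinarith
  have h4 : ‖G (n * Complex.I)‖ ≤ (c * n - |t|)⁻¹ := by
    simp only [hGdef]
    rw [norm_neg, norm_inv]
    exact inv_anti₀ (by linarith) h3
  calc _ ≤ (n : ℝ) * (c * n - |t|)⁻¹ := by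
        gcongr
        exact (Complex.im_le_norm _).trans h4
    _ = _ := by
        have : c * n - |t| ≠ 0 := by linarith
        have e : c - |t| * (n : ℝ)⁻¹ = (c * n - |t|) * (n : ℝ)⁻¹ := by field_simp
        rw [e, mul_inv, inv_inv, mul_comm]

/-- Elements of the Hardy space are bounded on `{Im s ≥ δ}`. -/
lemma exists_bound_of_le_im {F : ℍ → ℂ} (hF : F ∈ hardySubmodule) {δ : ℝ} (hδ : 0 < δ) :
    ∃ M : ℝ, ∀ s : ℂ, δ ≤ s.im → ‖F (UpperHalfPlane.ofComplex s)‖ ≤ M := by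
  obtain ⟨C, -, h⟩ := HardyH2.norm_apply_le (R := δ / 3) (by positivity)
  refine ⟨C * ‖(show HardyH2 from ⟨F, hF⟩)‖, fun s hs => h ⟨F, hF⟩ _ ?_⟩
  rw [UpperHalfPlane.ofComplex_apply_of_im_pos (hδ.trans_le hs)]
  show 2 * (δ / 3) < s.im
  linarith

/-- Elements of H² have no given values on the real line. Moving up by iδ produces a function on the
closed half-plane, where the Poisson and Cauchy formulas apply; δ tends to 0 at the end. -/
lemma IsAnalytic.shift {F : ℍ → ℂ} (hF : IsAnalytic F) {δ : ℝ} (hδ : 0 < δ) :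
    DifferentiableOn ℂ (fun s : ℂ => F (UpperHalfPlane.ofComplex (s + δ * Complex.I)))
      {z | 0 ≤ z.im} :=
  DifferentiableOn.comp (g := F ∘ UpperHalfPlane.ofComplex) (f := fun s : ℂ => s + δ * Complex.I)
    hF (by fun_prop) fun s (hs : 0 ≤ s.im) => by
      show 0 < (s + δ * Complex.I).im
      simp; linarith

lemma exists_bound_shift {F : ℍ → ℂ} (hF : F ∈ hardySubmodule) {δ : ℝ} (hδ : 0 < δ) :
    ∃ M : ℝ, ∀ s : ℂ, 0 ≤ s.im → ‖F (UpperHalfPlane.ofComplex (s + δ * Complex.I))‖ ≤ M := by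
  obtain ⟨M, hM⟩ := exists_bound_of_le_im hF hδ
  exact ⟨M, fun s hs => hM _ (by simp; linarith)⟩

lemma IsAnalytic.comp {F : ℍ → ℂ} (hF : IsAnalytic F) {φ : ℂ → ℂ}
    (hφ : DifferentiableOn ℂ φ {z | 0 < z.im}) (hself : ∀ z : ℍ, 0 < (φ z).im) :
    IsAnalytic fun z : ℍ => F ⟨φ z, hself z⟩ := by
  have h : DifferentiableOn ℂ ((F ∘ UpperHalfPlane.ofComplex) ∘ φ) {z | 0 < z.im} :=
    DifferentiableOn.comp hF hφ fun z hz => hself ⟨z, hz⟩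
  refine h.congr fun z hz => ?_
  have hz' : 0 < z.im := hz
  simp only [Function.comp_apply]
  rw [UpperHalfPlane.ofComplex_apply_of_im_pos (hself ⟨z, hz'⟩)]
  congr 1
  ext
  show φ (UpperHalfPlane.ofComplex z) = φ z
  rw [UpperHalfPlane.ofComplex_apply_of_im_pos hz']

/-- `sq_enorm_le_poisson` majorizes |F(φ(x + iy) + iδ)|² by the Poisson integral of |F(t + iδ)|² at
the point φ(x + iy). Integrating over x and exchanging the integrals leaves the average bounded by
1/c in `lintegral_poissonKer_le`, uniformly in t, y and δ. Fatou's lemma then removes δ. -/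
lemma eNorm_comp_le {φ : ℂ → ℂ} (hφ : DifferentiableOn ℂ φ {z | 0 < z.im})
    (hself : ∀ z : ℍ, 0 < (φ z).im) {c R₀ : ℝ} (hc : 0 < c)
    (hgrow : ∀ s : ℂ, 0 < s.im → R₀ ≤ ‖s‖ → c * ‖s‖ ≤ ‖φ s‖) {F : ℍ → ℂ}
    (hF : F ∈ hardySubmodule) :
    eNorm (fun z : ℍ => F ⟨φ z, hself z⟩) ≤ ENNReal.ofReal √(1 / c) * eNorm F := by
  have hself' : ∀ s : ℂ, 0 < s.im → 0 < (φ s).im := fun s hs => hself ⟨s, hs⟩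
  refine iSup₂_le fun y hy => ?_
  rw [← ENNReal.pow_le_pow_left_iff two_ne_zero, sq_eLpNorm_two, mul_pow,
    ← ENNReal.ofReal_pow (Real.sqrt_nonneg _), Real.sq_sqrt (by positivity)]
  have him : ∀ x : ℝ, 0 < ((x : ℂ) + y * Complex.I).im := fun x => by simpa using hy
  have hrow : ∀ x : ℝ, row (fun z : ℍ => F ⟨φ z, hself z⟩) y x =
      F (UpperHalfPlane.ofComplex (φ (x + y * Complex.I))) := by
    intro x
    unfold row
    rw [UpperHalfPlane.ofComplex_apply_of_im_pos (hself' _ (him x)),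
      UpperHalfPlane.ofComplex_apply_of_im_pos (him x)]
  simp_rw [hrow]
  have hcφ : Continuous fun x : ℝ => φ (x + y * Complex.I) :=
    hφ.continuousOn.comp_continuous (by fun_prop) him
  have hδ : ∀ δ : ℝ, 0 < δ → ∫⁻ x : ℝ,
      ‖F (UpperHalfPlane.ofComplex (φ (x + y * Complex.I) + δ * Complex.I))‖ₑ ^ 2 ≤
      ENNReal.ofReal (1 / c) * eNorm F ^ 2 := by
    intro δ hδ
    obtain ⟨M, hM⟩ := exists_bound_shift hF hδ
    have hmrow : Measurable fun t : ℝ => ‖row F δ t‖ₑ ^ 2 :=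
      ((hF.1.continuous_row hδ).measurable.enorm).pow_const 2
    have hmφ : Measurable fun x : ℝ => φ (x + y * Complex.I) := hcφ.measurable
    calc _ ≤ ∫⁻ x : ℝ, ∫⁻ t : ℝ, ENNReal.ofReal (poissonKer (φ (x + y * Complex.I)) t) *
          ‖row F δ t‖ₑ ^ 2 := lintegral_mono fun x =>
            sq_enorm_le_poisson (hF.1.shift hδ) hM (hself' _ (him x))
      _ = ∫⁻ t : ℝ, ∫⁻ x : ℝ, ENNReal.ofReal (poissonKer (φ (x + y * Complex.I)) t) *
          ‖row F δ t‖ₑ ^ 2 := by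
          refine lintegral_lintegral_swap ?_
          refine Measurable.aemeasurable ?_
          refine Measurable.mul ?_ (hmrow.comp measurable_snd)
          exact (measurable_poissonKer.comp
            ((hmφ.comp measurable_fst).prodMk measurable_snd)).ennreal_ofReal
      _ = ∫⁻ t : ℝ, (∫⁻ x : ℝ, ENNReal.ofReal (poissonKer (φ (x + y * Complex.I)) t)) *
          ‖row F δ t‖ₑ ^ 2 := by
          refine lintegral_congr fun t => lintegral_mul_const' _ _ ?_
          exact (ENNReal.pow_lt_top enorm_lt_top).ne
      _ ≤ ∫⁻ t : ℝ, ENNReal.ofReal (1 / c) * ‖row F δ t‖ₑ ^ 2 := by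
          refine lintegral_mono fun t => ?_
          gcongr
          exact lintegral_poissonKer_le hφ hself' hc hgrow hy t
      _ = ENNReal.ofReal (1 / c) * eLpNorm (row F δ) 2 volume ^ 2 := by
          rw [lintegral_const_mul' _ _ ENNReal.ofReal_ne_top, sq_eLpNorm_two]
      _ ≤ _ := by
          gcongr
          exact row_le_eNorm F hδ
  have hcont : ∀ δ : ℝ, 0 ≤ δ → Continuous fun x : ℝ =>
      F (UpperHalfPlane.ofComplex (φ (x + y * Complex.I) + δ * Complex.I)) := by
    intro δ hδ0
    refine hF.1.continuousOn.comp_continuous (hcφ.add continuous_const) fun x => ?_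
    show 0 < (φ (x + y * Complex.I) + δ * Complex.I).im
    have := hself' _ (him x)
    simp; linarith
  have hfat := lintegral_liminf_le (u := atTop) (μ := (volume : Measure ℝ)) (f := fun (n : ℕ) (x : ℝ) =>
    ‖F (UpperHalfPlane.ofComplex (φ (x + y * Complex.I) +
      ((1 / ((n : ℝ) + 1) : ℝ) : ℂ) * Complex.I))‖ₑ ^ 2) (fun n =>
      ((hcont _ (by positivity)).measurable.enorm).pow_const 2)
  refine le_trans (le_of_eq (lintegral_congr fun x => ?_)) (hfat.trans
    (liminf_le_of_le (by isBoundedDefault) fun b hb => ?_))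
  · refine (Tendsto.liminf_eq ?_).symm
    refine ((ENNReal.continuous_pow 2).tendsto _).comp ?_
    refine (continuous_enorm.tendsto _).comp ?_
    have hct : ContinuousAt (F ∘ UpperHalfPlane.ofComplex) (φ (x + y * Complex.I)) :=
      (hF.1.differentiableAt (hself' _ (him x))).continuousAt
    refine hct.tendsto.comp ?_
    have h1 : Tendsto (fun n : ℕ => ((1 / ((n : ℝ) + 1) : ℝ) : ℂ)) atTop (𝓝 ((0 : ℝ) : ℂ)) :=
      (Complex.continuous_ofReal.tendsto 0).comp
        (tendsto_one_div_add_atTop_nhds_zero_nat (𝕜 := ℝ))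
    have := (h1.mul_const Complex.I).const_add (φ (x + y * Complex.I))
    simpa using this
  · obtain ⟨n, hn⟩ := hb.exists
    exact hn.trans (hδ _ (by positivity))

end HalfPlaneHardy

/-- Composition with a self-map of the half-plane that grows at least linearly. -/
lemma HardyH2.exists_compositionOperator {φ : ℂ → ℂ} (hφ : DifferentiableOn ℂ φ {z | 0 < z.im})
    (hself : ∀ z : ℍ, 0 < (φ z).im) {c R₀ : ℝ} (hc : 0 < c)
    (hgrow : ∀ s : ℂ, 0 < s.im → R₀ ≤ ‖s‖ → c * ‖s‖ ≤ ‖φ s‖) :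
    ∃ Cφ : HardyH2 →L[ℂ] HardyH2, ∀ (f : HardyH2) (z : ℍ), Cφ f z = f ⟨φ z, hself z⟩ := by
  have hfin : ∀ f : HardyH2, ENNReal.ofReal √(1 / c) * eNorm f.1 < ∞ := fun f =>
    ENNReal.mul_lt_top ENNReal.ofReal_lt_top f.2.2
  let L : HardyH2 →ₗ[ℂ] HardyH2 :=
    { toFun := fun f => (⟨fun z => f ⟨φ z, hself z⟩, f.2.1.comp hφ hself,
        (eNorm_comp_le hφ hself hc hgrow f.2).trans_lt (hfin f)⟩ : hardySubmodule)
      map_add' := fun f g => rfl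
      map_smul' := fun a f => rfl }
  refine ⟨L.mkContinuous √(1 / c) fun f => ?_, fun f z => rfl⟩
  have h := ENNReal.toReal_mono (hfin f).ne (eNorm_comp_le hφ hself hc hgrow f.2)
  rwa [ENNReal.toReal_mul, ENNReal.toReal_ofReal (Real.sqrt_nonneg _)] at h

/-! ### Cauchy's formula and the reproducing kernel -/

namespace HalfPlaneHardy

/-- Bounds for the regularizing factor in/(s + in): it decays like 1/|s| for fixed n, stays bounded
by 1, and tends to 1 as n grows. -/
lemma norm_div_add_mul_I_le {s : ℂ} (hs : 0 ≤ s.im) {n : ℝ} (hn : 0 < n) :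
    ‖n * Complex.I / (s + n * Complex.I)‖ ≤ 1 ∧ ‖s‖ ≤ ‖s + n * Complex.I‖ := by
  have h1 : n ≤ ‖s + n * Complex.I‖ := by
    have := Complex.im_le_norm (s + n * Complex.I)
    simp at this
    linarith
  constructor
  · rw [norm_div, norm_mul, Complex.norm_I, mul_one, Complex.norm_real, Real.norm_of_nonneg hn.le]
    exact div_le_one_of_le₀ h1 (norm_nonneg _)
  · rw [← sq_le_sq₀ (norm_nonneg _) (norm_nonneg _), ← Complex.normSq_eq_norm_sq,
      ← Complex.normSq_eq_norm_sq, Complex.normSq_apply, Complex.normSq_apply]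
    simp
    nlinarith

/-- The Cauchy formula on the half-plane for bounded functions with square-integrable boundary
values. -/
lemma cauchy_formula {F : ℂ → ℂ} (hF : DifferentiableOn ℂ F {z | 0 ≤ z.im}) {M : ℝ}
    (hM : ∀ s : ℂ, 0 ≤ s.im → ‖F s‖ ≤ M) (h2 : MemLp (fun x : ℝ => F x) 2 volume) {u : ℂ}
    (hu : 0 < u.im) :
    ∫ x : ℝ, F x / (x - u) = 2 * Real.pi * Complex.I * F u := by
  have hM0 : 0 ≤ M := (norm_nonneg _).trans (hM u hu.le)
  have hpi : (Real.pi : ℂ) ≠ 0 := by exact_mod_cast Real.pi_ne_zero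
  have hden : ∀ (n : ℕ), 0 < n → ∀ s : ℂ, 0 ≤ s.im → s + n * Complex.I ≠ 0 := by
    intro n hn s hs h
    have h' := congrArg Complex.im h
    have hn' : (0:ℝ) < n := by exact_mod_cast hn
    simp at h'
    linarith
  have key : ∀ n : ℕ, 0 < n → ∫ x : ℝ, F x / (x - u) * (n * Complex.I / (x + n * Complex.I)) =
      2 * Real.pi * Complex.I * F u * (n * Complex.I / (u + n * Complex.I)) := by
    intro n hn
    have hn' : (0:ℝ) < n := by exact_mod_cast hn
    -- The factor s - conj u cancels one half of |x - u|² in the Poisson kernel and leaves the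
    -- Cauchy kernel 1/(x - u). The factor in/(s + in) compensates its growth, so that the product
    -- is bounded by M(n + |u|).
    have h := poisson_formula
      (F := fun s => F s * ((s - conj u) * (n * Complex.I / (s + n * Complex.I)))) (u := u)
      (M := M * (n + ‖u‖)) ?_ ?_ hu
    · have e : ∀ x : ℝ, (poissonKer u x : ℂ) * (F x * ((x - conj u) *
          (n * Complex.I / (x + n * Complex.I)))) =
          (u.im / Real.pi : ℂ) * (F x / (x - u) * (n * Complex.I / (x + n * Complex.I))) := by
        intro x
        have h1 := ofReal_sub_ne_zero hu.ne' x
        have h3 := ofReal_sub_ne_zero (u := conj u) (by simpa using hu.ne') x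
        rw [poissonKer, Complex.ofReal_div, ← ofReal_sub_mul_conj, Complex.ofReal_div]
        field_simp
      simp_rw [e] at h
      rw [integral_const_mul] at h
      have hui : (u.im : ℂ) ≠ 0 := by exact_mod_cast hu.ne'
      have e2 : u - conj u = 2 * u.im * Complex.I := by
        rw [Complex.sub_conj]; push_cast; ring
      rw [e2] at h
      have h4 : (u.im / Real.pi : ℂ) ≠ 0 := div_ne_zero hui hpi
      refine mul_left_cancel₀ h4 (h.trans ?_)
      field_simp
    · refine hF.mul (DifferentiableOn.mul (by fun_prop) ?_)
      exact DifferentiableOn.div (by fun_prop) (by fun_prop) fun s hs => hden n hn s hs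
    · intro s hs
      have h3 := (norm_div_add_mul_I_le hs hn').1
      have h4 := (norm_div_add_mul_I_le hs hn').2
      have h5 : 0 < ‖s + n * Complex.I‖ := norm_pos_iff.2 (hden n hn s hs)
      rw [norm_mul]
      refine mul_le_mul (hM s hs) ?_ (norm_nonneg _) hM0
      simp only [Complex.ofReal_natCast] at h3 h4
      calc _ ≤ (‖s‖ + ‖u‖) * ‖(n : ℂ) * Complex.I / (s + n * Complex.I)‖ := by
            rw [norm_mul]
            gcongr
            refine (norm_sub_le _ _).trans ?_
            rw [Complex.norm_conj]
        _ = n * (‖s‖ / ‖s + n * Complex.I‖) +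
            ‖u‖ * ‖(n : ℂ) * Complex.I / (s + n * Complex.I)‖ := by
            rw [norm_div, norm_mul, Complex.norm_I, mul_one, Complex.norm_natCast]; ring
        _ ≤ n * 1 + ‖u‖ * 1 := by
            gcongr
            exact div_le_one_of_le₀ h4 (norm_nonneg _)
        _ = _ := by ring
  have hlim1 : ∀ s : ℂ, Tendsto (fun n : ℕ => (n : ℂ) * Complex.I / (s + n * Complex.I)) atTop
      (𝓝 1) := by
    intro s
    have h : Tendsto (fun n : ℕ => ((n : ℂ))⁻¹) atTop (𝓝 0) :=
      tendsto_inv_atTop_nhds_zero_nat (𝕜 := ℂ)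
    have h3 := ((h.const_mul (s / Complex.I)).const_add 1).inv₀ (by simp)
    simp only [mul_zero, add_zero, inv_one] at h3
    refine h3.congr' ?_
    filter_upwards [eventually_gt_atTop 0] with n hn
    have hn' : (n : ℂ) ≠ 0 := by exact_mod_cast hn.ne'
    have e : s + n * Complex.I = (n * Complex.I) * (1 + s / Complex.I * (n : ℂ)⁻¹) := by
      field_simp
      ring
    rw [e, div_mul_eq_div_div, div_self (mul_ne_zero hn' Complex.I_ne_zero), one_div]
  have hcF := continuousOn_ofReal_row hF
  have hcu : Continuous fun x : ℝ => ((x : ℂ) - u)⁻¹ :=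
    Continuous.inv₀ (by fun_prop) fun x => ofReal_sub_ne_zero hu.ne' x
  have hint : Integrable fun x : ℝ => F x / (x - u) := by
    have hm : MemLp (fun x : ℝ => ((x : ℂ) - u)⁻¹) 2 volume := by
      rw [memLp_two_iff_integrable_sq_norm hcu.aestronglyMeasurable]
      simpa using integrable_inv_norm_sq hu.ne'
    exact h2.integrable_mul hm
  -- Both F and 1/(x - u) are square-integrable on the line, so |F/(x - u)| dominates, and the
  -- regularizing factor disappears in the limit.
  have hdct := tendsto_integral_of_dominated_convergence (μ := (volume : Measure ℝ))
    (F := fun (n : ℕ) (x : ℝ) => F x / (x - u) * ((n : ℂ) * Complex.I / (x + n * Complex.I)))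
    (f := fun x : ℝ => F x / (x - u)) (fun x => ‖F x / (x - u)‖) ?_ hint.norm ?_ ?_
  · refine tendsto_nhds_unique hdct ?_
    have := (hlim1 u).const_mul (2 * Real.pi * Complex.I * F u)
    rw [mul_one] at this
    refine this.congr' ?_
    filter_upwards [eventually_gt_atTop 0] with n hn
    exact (key n hn).symm
  · intro n
    refine hint.aestronglyMeasurable.mul (Measurable.aestronglyMeasurable ?_)
    exact (measurable_const).div (by fun_prop : Continuous _).measurable
  · intro n
    refine Eventually.of_forall fun x => ?_
    rw [norm_mul]
    rcases Nat.eq_zero_or_pos n with rfl | hn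
    · simp; positivity
    · have hn' : (0:ℝ) < n := by exact_mod_cast hn
      have := (norm_div_add_mul_I_le (s := x) (by simp) hn').1
      simp only [Complex.ofReal_natCast] at this
      exact mul_le_of_le_one_right (norm_nonneg _) this
  · refine Eventually.of_forall fun x => ?_
    simpa using (hlim1 x).const_mul (F x / (x - u))

end HalfPlaneHardy

namespace HardyH2

lemma memLp_row (f : HardyH2) {y : ℝ} (hy : 0 < y) : MemLp (row f y) 2 volume :=
  ⟨f.2.1.aesm_row hy _, (row_le_eNorm _ hy).trans_lt f.2.2⟩

/-- The inner product is the limit of the inner products over horizontal lines. -/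
lemma tendsto_inner (f g : HardyH2) :
    Tendsto (fun n : ℕ => ∫ x : ℝ, conj (row f (1 / ((n : ℝ) + 1)) x) *
      row g (1 / ((n : ℝ) + 1)) x) atTop (𝓝 (inner ℂ f g)) := by
  have hpos : ∀ n : ℕ, (0:ℝ) < 1 / ((n : ℝ) + 1) := fun n => by positivity
  have t : ∀ h : HardyH2, Tendsto (fun n : ℕ =>
      ((‖(memLp_row h (hpos n)).toLp‖ : ℝ) : ℂ) ^ 2) atTop (𝓝 (((‖h‖ : ℝ) : ℂ) ^ 2)) := by
    intro h
    have h1 := (ENNReal.tendsto_toReal h.2.2.ne).comp (tendsto_eLpNorm_row h.2.1 h.2.2)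
    have h2 := ((Complex.continuous_ofReal.tendsto _).comp h1).pow 2
    refine h2.congr fun n => ?_
    rw [Lp.norm_toLp]
    rfl
  -- The inner product comes from the norm by polarization, so convergence of the four norms of `f ±
  -- g`, `f ± I • g` on the lines suffices.
  rw [inner_eq_sum_norm_sq_div_four]
  have := (((t (f + g)).sub (t (f - g))).add (((t (f - Complex.I • g)).sub
    (t (f + Complex.I • g))).mul_const Complex.I)).div_const 4
  refine this.congr fun n => ?_
  have e1 : ∫ x : ℝ, conj (row f (1 / ((n : ℝ) + 1)) x) * row g (1 / ((n : ℝ) + 1)) x =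
      inner ℂ ((memLp_row f (hpos n)).toLp) ((memLp_row g (hpos n)).toLp) := by
    rw [MeasureTheory.L2.inner_def]
    refine integral_congr_ae ?_
    filter_upwards [(memLp_row f (hpos n)).coeFn_toLp, (memLp_row g (hpos n)).coeFn_toLp] with x h1 h2
    rw [h1, h2]
    simp [mul_comm]
  rw [e1, inner_eq_sum_norm_sq_div_four]
  simp only [← MemLp.toLp_const_smul, ← MemLp.toLp_add, ← MemLp.toLp_sub]
  rfl

/-- At height y the squared modulus is 1/(4π² |x - (w + iy)|²), with integral 1/(4π Im(w + iy)); the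
bound is the limit of this as y tends to 0. -/
lemma kernel_mem_hardySubmodule (w : ℍ) : (fun z : ℍ => Complex.I / (2 * Real.pi * (z - conj (w : ℂ)))) ∈
    hardySubmodule := by
  have hpi : (Real.pi : ℂ) ≠ 0 := by exact_mod_cast Real.pi_ne_zero
  have hw : 0 < (w : ℂ).im := w.im_pos
  constructor
  · have h : DifferentiableOn ℂ (fun z : ℂ => Complex.I / (2 * Real.pi * (z - conj (w : ℂ))))
        {z | 0 < z.im} := by
      refine DifferentiableOn.div (by fun_prop) (by fun_prop) fun s (hs : 0 < s.im) h => ?_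
      rcases mul_eq_zero.1 h with h | h
      · simp [Real.pi_ne_zero] at h
      · have := congrArg Complex.im h
        simp at this
        have hw' := w.im_pos
        linarith
    refine h.congr fun z hz => ?_
    simp only [Function.comp_apply]
    rw [UpperHalfPlane.ofComplex_apply_of_im_pos hz]
  · refine lt_of_le_of_lt (iSup₂_le (a := ENNReal.ofReal √(1 / (4 * Real.pi * (w : ℂ).im)))
      fun y hy => ?_) ENNReal.ofReal_lt_top
    rw [← ENNReal.pow_le_pow_left_iff two_ne_zero, sq_eLpNorm_two,
      ← ENNReal.ofReal_pow (Real.sqrt_nonneg _), Real.sq_sqrt (by positivity)]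
    have hu : 0 < ((w : ℂ) + y * Complex.I).im := by simp; have := w.im_pos; linarith
    have e : ∀ x : ℝ, ‖row (fun z : ℍ => Complex.I / (2 * Real.pi * (z - conj (w : ℂ)))) y x‖ₑ ^ 2 =
        ENNReal.ofReal ((1 / (4 * Real.pi ^ 2)) * (‖(x : ℂ) - (w + y * Complex.I)‖ ^ 2)⁻¹) := by
      intro x
      have hx : 0 < ((x : ℂ) + y * Complex.I).im := by simpa using hy
      have h1 : ‖(x : ℂ) + y * Complex.I - conj (w : ℂ)‖ = ‖(x : ℂ) - (w + y * Complex.I)‖ := by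
        rw [← Complex.norm_conj]
        congr 1
        simp
        ring
      rw [row, UpperHalfPlane.ofComplex_apply_of_im_pos hx, ← ofReal_norm,
        ← ENNReal.ofReal_pow (norm_nonneg _)]
      congr 1
      simp only [norm_div, norm_mul, Complex.norm_I]
      rw [h1, Complex.norm_real, Real.norm_of_nonneg Real.pi_pos.le]
      simp only [Complex.norm_ofNat]
      field_simp
      norm_num
    simp_rw [e]
    rw [← ofReal_integral_eq_lintegral_ofReal ((integrable_inv_norm_sq hu.ne').const_mul _)
      (Eventually.of_forall fun x => by positivity), integral_const_mul, integral_inv_norm_sq hu]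
    refine ENNReal.ofReal_le_ofReal ?_
    have h3 : (w : ℂ).im ≤ ((w : ℂ) + y * Complex.I).im := by simp; exact hy.le
    calc _ = 1 / (4 * Real.pi * ((w : ℂ) + y * Complex.I).im) := by
          have := Real.pi_ne_zero
          field_simp
      _ ≤ _ := by gcongr

/-- The reproducing kernel of the Hardy space. -/
noncomputable def kernel (w : ℍ) : HardyH2 :=
  (⟨fun z : ℍ => Complex.I / (2 * Real.pi * (z - conj (w : ℂ))), kernel_mem_hardySubmodule w⟩ :
    hardySubmodule)

lemma kernel_apply (w z : ℍ) : kernel w z = Complex.I / (2 * Real.pi * (z - conj (w : ℂ))) := rfl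

/-- At height y the conjugated kernel is the Cauchy kernel with pole w + iy, and f is shifted by iy
as well, so the integral equals f(w + 2iy). Letting y tend to 0 gives f(w). -/
lemma inner_kernel (w : ℍ) (f : HardyH2) : inner ℂ (kernel w) f = f w := by
  refine tendsto_nhds_unique (tendsto_inner (kernel w) f) ?_
  have hpi : (Real.pi : ℂ) ≠ 0 := by exact_mod_cast Real.pi_ne_zero
  have hw : 0 < (w : ℂ).im := w.im_pos
  have key : ∀ y : ℝ, 0 < y → ∫ x : ℝ, conj (row (kernel w) y x) * row f y x =
      f (UpperHalfPlane.ofComplex (w + 2 * y * Complex.I)) := by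
    intro y hy
    have hu : 0 < ((w : ℂ) + y * Complex.I).im := by simp; have := w.im_pos; linarith
    obtain ⟨M, hM⟩ := exists_bound_shift f.2 hy
    have h := cauchy_formula (f.2.1.shift hy) hM (f.memLp_row hy) hu
    have e : ∀ x : ℝ, conj (row (kernel w) y x) * row f y x = (2 * Real.pi * Complex.I)⁻¹ *
        (f.1 (UpperHalfPlane.ofComplex (x + y * Complex.I)) / (x - (w + y * Complex.I))) := by
      intro x
      have hx : 0 < ((x : ℂ) + y * Complex.I).im := by simpa using hy
      have h1 := ofReal_sub_ne_zero hu.ne' x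
      have h2 : conj (row (kernel w) y x) =
          (2 * Real.pi * Complex.I)⁻¹ * ((x : ℂ) - (w + y * Complex.I))⁻¹ := by
        rw [row, kernel_apply, UpperHalfPlane.ofComplex_apply_of_im_pos hx]
        simp only [map_div₀, map_mul, map_sub, map_add, Complex.conj_I, Complex.conj_conj,
          Complex.conj_ofReal, map_ofNat]
        have h3 : (x : ℂ) + y * (-Complex.I) - w = x - (w + y * Complex.I) := by ring
        rw [h3, ← Complex.inv_I, div_eq_mul_inv, ← mul_inv, ← mul_inv]
        congr 1
        ring
      rw [h2, row]
      ring
    simp_rw [e]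
    rw [integral_const_mul, h, ← mul_assoc, inv_mul_cancel₀ (by simp [hpi]), one_mul]
    have e2 : (w : ℂ) + y * Complex.I + y * Complex.I = w + 2 * y * Complex.I := by ring
    rw [e2]
  simp_rw [fun n : ℕ => key (1 / ((n : ℝ) + 1)) (by positivity)]
  have hct : ContinuousAt ((f : ℍ → ℂ) ∘ UpperHalfPlane.ofComplex) w :=
    (f.2.1.differentiableAt hw).continuousAt
  have h0 : f w = ((f : ℍ → ℂ) ∘ UpperHalfPlane.ofComplex) w := by
    simp
  rw [h0]
  refine hct.tendsto.comp ?_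
  have h1 : Tendsto (fun n : ℕ => ((1 / ((n : ℝ) + 1) : ℝ) : ℂ)) atTop (𝓝 ((0 : ℝ) : ℂ)) :=
    (Complex.continuous_ofReal.tendsto 0).comp
      (tendsto_one_div_add_atTop_nhds_zero_nat (𝕜 := ℝ))
  have := ((h1.const_mul 2).mul_const Complex.I).const_add (w : ℂ)
  simpa using this

end HardyH2

/-! ### Partial fractions and sums of residues of rational functions -/

/-- Partial fractions over the complex numbers. -/
lemma Polynomial.exists_eval_div_eq_sum {P D : Polynomial ℂ} (hD : D ≠ 0) (hdeg : P.degree < D.degree) :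
    ∃ (n : ℂ → ℕ) (c : (t : ℂ) → Fin (n t) → ℂ), ∀ s : ℂ, D.eval s ≠ 0 →
      P.eval s / D.eval s =
        ∑ t ∈ D.roots.toFinset, ∑ j, c t j * ((s - t) ^ (j.1 + 1))⁻¹ := by
  classical
  set S := D.roots.toFinset
  set n : ℂ → ℕ := fun t => D.rootMultiplicity t
  set A : Polynomial ℂ := ∏ t ∈ S, (Polynomial.X - Polynomial.C t) ^ n t with hA
  have hfac : D = Polynomial.C D.leadingCoeff * A := by
    rw [hA, ← Polynomial.prod_multiset_root_eq_finset_root]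
    exact (IsAlgClosed.splits D).eq_prod_roots
  have hlc : D.leadingCoeff ≠ 0 := Polynomial.leadingCoeff_ne_zero.2 hD
  have hAmonic : A.Monic := Polynomial.monic_prod_of_monic _ _ fun t _ =>
    (Polynomial.monic_X_sub_C t).pow _
  have hAdeg : A.degree = D.degree := by
    conv_rhs => rw [hfac]
    rw [Polynomial.degree_C_mul hlc]
  obtain ⟨q, r, hr, hP⟩ := Polynomial.eq_quo_mul_prod_pow_add_sum_rem_mul_prod_pow P
    (s := S) (g := fun t : ℂ => Polynomial.X - Polynomial.C t)
    (fun t _ => Polynomial.monic_X_sub_C t)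
    (fun a _ b _ hab => Polynomial.isCoprime_X_sub_C_of_isUnit_sub (sub_ne_zero.2 hab).isUnit) n
  have hrC : ∀ t ∈ S, ∀ j, r t j = Polynomial.C ((r t j).coeff 0) := by
    intro t ht j
    have := hr t ht j
    rw [Polynomial.degree_X_sub_C] at this
    exact Polynomial.eq_C_of_degree_le_zero (Nat.WithBot.lt_one_iff_le_zero.1 this)
  have hsplit : ∀ t ∈ S, A = (Polynomial.X - Polynomial.C t) ^ n t *
      ∏ k ∈ S.erase t, (Polynomial.X - Polynomial.C k) ^ n k := fun t ht =>
    (Finset.mul_prod_erase S _ ht).symm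
  have hterm : ∀ t ∈ S, ∀ j : Fin (n t), (r t j * (Polynomial.X - Polynomial.C t) ^ j.1 *
      ∏ k ∈ S.erase t, (Polynomial.X - Polynomial.C k) ^ n k).degree < A.degree := by
    intro t ht j
    have hm : (∏ k ∈ S.erase t, (Polynomial.X - Polynomial.C k) ^ n k).Monic :=
      Polynomial.monic_prod_of_monic _ _ fun t _ => (Polynomial.monic_X_sub_C t).pow _
    rw [hsplit t ht, hrC t ht j, mul_assoc, ← Polynomial.smul_eq_C_mul]
    refine lt_of_le_of_lt (Polynomial.degree_smul_le _ _) ?_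
    rw [Polynomial.degree_mul, Polynomial.degree_mul, Polynomial.degree_pow, Polynomial.degree_pow,
      Polynomial.degree_X_sub_C, Polynomial.degree_eq_natDegree hm.ne_zero]
    simp only [nsmul_eq_mul, mul_one]
    exact_mod_cast Nat.add_lt_add_right j.2 _
  -- P and all the remainder terms have degree below that of A, hence so does q · A. A proper
  -- fraction has no polynomial part.
  have hq : q = 0 := by
    by_contra hq
    have h1 : (q * A).degree < A.degree := by
      have e : q * A = P - ∑ t ∈ S, ∑ j, r t j * (Polynomial.X - Polynomial.C t) ^ j.1 *
          ∏ k ∈ S.erase t, (Polynomial.X - Polynomial.C k) ^ n k := by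
        rw [eq_sub_iff_add_eq]; exact hP.symm
      rw [e, Polynomial.degree_eq_natDegree hAmonic.ne_zero, ← Polynomial.mem_degreeLT]
      refine Submodule.sub_mem _ ?_ (Submodule.sum_mem _ fun t ht => Submodule.sum_mem _ fun j _ => ?_)
      · rw [Polynomial.mem_degreeLT, ← Polynomial.degree_eq_natDegree hAmonic.ne_zero, hAdeg]
        exact hdeg
      · rw [Polynomial.mem_degreeLT, ← Polynomial.degree_eq_natDegree hAmonic.ne_zero]
        exact hterm t ht j
    rw [Polynomial.degree_mul, Polynomial.degree_eq_natDegree hq,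
      Polynomial.degree_eq_natDegree hAmonic.ne_zero] at h1
    have h2 : q.natDegree + A.natDegree < A.natDegree := by exact_mod_cast h1
    omega
  -- The remainder `r t j` comes with (X - t)^j in the numerator, that is, with a pole of order n t
  -- - j. Reversing the index makes the pole order j + 1.
  refine ⟨n, fun t j => (r t j.rev).coeff 0 / D.leadingCoeff, fun s hs => ?_⟩
  have hDs : D.eval s = D.leadingCoeff * A.eval s := by
    conv_lhs => rw [hfac]
    simp
  have hAs : A.eval s ≠ 0 := fun h => hs (by rw [hDs, h, mul_zero])
  have hPs := congrArg (Polynomial.eval s) hP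
  rw [hq, zero_mul, zero_add, Polynomial.eval_finsetSum] at hPs
  rw [hPs, Finset.sum_div]
  refine Finset.sum_congr rfl fun t ht => ?_
  rw [Polynomial.eval_finsetSum, Finset.sum_div, ← Equiv.sum_comp Fin.revPerm]
  refine Finset.sum_congr rfl fun j _ => ?_
  have hst : s - t ≠ 0 := by
    intro h
    refine hs ?_
    rw [sub_eq_zero.1 h]
    exact (Polynomial.mem_roots hD).1 (Multiset.mem_toFinset.1 ht)
  have hA' : A.eval s = (s - t) ^ n t *
      (∏ k ∈ S.erase t, (Polynomial.X - Polynomial.C k) ^ n k).eval s := by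
    conv_lhs => rw [hsplit t ht]
    simp
  have hB : (∏ k ∈ S.erase t, (Polynomial.X - Polynomial.C k) ^ n k).eval s ≠ 0 := fun h =>
    hAs (by rw [hA', h, mul_zero])
  have hn : (s - t) ^ n t = (s - t) ^ (j.rev : ℕ) * (s - t) ^ (j.1 + 1) := by
    rw [← pow_add, Fin.val_rev]
    congr 1
    have := j.2
    omega
  rw [hDs, hA', hn, Polynomial.eval_mul, Polynomial.eval_mul]
  simp only [Fin.revPerm_apply]
  have hrr : (r t j.rev).eval s = (r t j.rev).coeff 0 := by
    conv_lhs => rw [hrC t ht]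
    simp
  rw [hrr]
  simp only [Polynomial.eval_pow, Polynomial.eval_sub, Polynomial.eval_X, Polynomial.eval_C]
  field_simp

/-- Since b lies outside the disc, k = 0 is Cauchy's formula for 1/(s - b). The identity 1/((s -
t)(s - b)) = (b - t)⁻¹ (1/(s - b) - 1/(s - t)) lowers the order, and the extra term (s - t)^(-k-2)
has a primitive. -/
lemma circleIntegral_inv_pow_mul_inv_sub {t b : ℂ} {r : ℝ} (hr : 0 < r) (hb : r < ‖b - t‖) (k : ℕ) :
    ∮ s in C(t, r), ((s - t) ^ (k + 1))⁻¹ * (s - b)⁻¹ =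
      -(2 * Real.pi * Complex.I) * ((b - t) ^ (k + 1))⁻¹ := by
  have hbt : b - t ≠ 0 := norm_pos_iff.1 (hr.trans hb)
  have hsb : ∀ s ∈ Metric.closedBall t r, s - b ≠ 0 := by
    intro s hs h
    rw [sub_eq_zero.1 h, Metric.mem_closedBall, dist_eq_norm] at hs
    linarith
  have hst : ∀ s ∈ Metric.sphere t r, s - t ≠ 0 := fun s hs h => by
    rw [mem_sphere_iff_norm, h, norm_zero] at hs
    exact hr.ne hs
  have hss : Metric.sphere t r ⊆ Metric.closedBall t r := Metric.sphere_subset_closedBall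
  induction k with
  | zero =>
    have hd : DifferentiableOn ℂ (fun s : ℂ => (s - b)⁻¹) (Metric.closedBall t r) :=
      DifferentiableOn.inv (by fun_prop) hsb
    have := hd.circleIntegral_sub_inv_smul (Metric.mem_ball_self hr)
    simp only [smul_eq_mul] at this
    simp only [zero_add, pow_one, this]
    rw [← neg_sub b t, inv_neg]
    ring
  | succ k ih =>
    have hc : ∀ m : ℕ, ContinuousOn (fun s : ℂ => ((s - t) ^ m)⁻¹) (Metric.sphere t r) := fun m =>
      ContinuousOn.inv₀ (by fun_prop) fun s hs => pow_ne_zero _ (hst s hs)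
    have hcb : ContinuousOn (fun s : ℂ => (s - b)⁻¹) (Metric.sphere t r) :=
      ContinuousOn.inv₀ (by fun_prop) fun s hs => hsb s (hss hs)
    have e : EqOn (fun s : ℂ => ((s - t) ^ (k + 1 + 1))⁻¹ * (s - b)⁻¹)
        (fun s : ℂ => (b - t)⁻¹ * (((s - t) ^ (k + 1))⁻¹ * (s - b)⁻¹ - ((s - t) ^ (k + 2))⁻¹))
        (Metric.sphere t r) := by
      intro s hs
      have h1 := hst s hs
      have h2 := hsb s (hss hs)
      simp only
      field_simp
      ring
    have hcm : ContinuousOn (fun s : ℂ => ((s - t) ^ (k + 1))⁻¹ * (s - b)⁻¹) (Metric.sphere t r) :=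
      (hc _).mul hcb
    have hz : ∮ s in C(t, r), ((s - t) ^ (k + 2))⁻¹ = 0 := by
      have := circleIntegral.integral_sub_zpow_of_ne (n := -((k + 2 : ℕ) : ℤ)) (by push_cast; omega) t t r
      simpa only [zpow_neg, zpow_natCast] using this
    rw [circleIntegral.integral_congr hr.le e, circleIntegral.integral_const_mul,
      circleIntegral.integral_sub (hcm.circleIntegrable hr.le)
        ((hc _).circleIntegrable hr.le), ih, hz]
    field_simp
    ring

/-- The residues of a rational function that is `O(|s|⁻²)` at infinity add up to zero; one of the
poles, `b`, is singled out. -/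
lemma sum_circleIntegral_rational {P D : Polynomial ℂ} (hD : D ≠ 0) (hdeg : P.degree < D.degree)
    {b : ℂ} (hb : D.eval b ≠ 0) {r : ℂ → ℝ} (hr : ∀ t ∈ D.roots.toFinset, 0 < r t)
    (hrb : ∀ t ∈ D.roots.toFinset, r t < ‖b - t‖)
    (hrD : ∀ t ∈ D.roots.toFinset, ∀ s ∈ Metric.closedBall t (r t), s ≠ t → D.eval s ≠ 0) :
    ∑ t ∈ D.roots.toFinset, (2 * Real.pi * Complex.I)⁻¹ *
      ∮ s in C(t, r t), P.eval s / D.eval s * (s - b)⁻¹ = -(P.eval b / D.eval b) := by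
  have h2pi : (2 * Real.pi * Complex.I : ℂ) ≠ 0 := Complex.two_pi_I_ne_zero
  obtain ⟨n, c, hc⟩ := Polynomial.exists_eval_div_eq_sum hD hdeg
  -- Each principal part c/(s - t)^(j+1), multiplied by 1/(s - b), has residue -c/(b - t)^(j+1) at
  -- t. This is minus its own value at b, so the sum is minus the partial fraction expansion at b.
  rw [hc b hb, ← Finset.sum_neg_distrib]
  refine Finset.sum_congr rfl fun t ht => ?_
  have hr0 := hr t ht
  have hne : ∀ s ∈ Metric.sphere t (r t), s ≠ t := fun s hs h => by
    rw [h, mem_sphere_iff_norm, sub_self, norm_zero] at hs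
    exact hr0.ne hs
  have hss : Metric.sphere t (r t) ⊆ Metric.closedBall t (r t) := Metric.sphere_subset_closedBall
  have hsb : ∀ s ∈ Metric.closedBall t (r t), s - b ≠ 0 := by
    intro s hs h
    rw [sub_eq_zero.1 h, Metric.mem_closedBall, dist_eq_norm] at hs
    linarith [hrb t ht]
  have hroot : ∀ t' ∈ D.roots.toFinset, D.eval t' = 0 := fun t' ht' =>
    (Polynomial.mem_roots hD).1 (Multiset.mem_toFinset.1 ht')
  have hst' : ∀ t' ∈ D.roots.toFinset, t' ≠ t → ∀ s ∈ Metric.closedBall t (r t), s - t' ≠ 0 := by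
    intro t' ht' hne' s hs h
    rw [sub_eq_zero.1 h] at hs
    exact hrD t ht t' hs hne' (hroot t' ht')
  have hcb : ContinuousOn (fun s : ℂ => (s - b)⁻¹) (Metric.sphere t (r t)) :=
    ContinuousOn.inv₀ (by fun_prop) fun s hs => hsb s (hss hs)
  have hst : ∀ t' ∈ D.roots.toFinset, ∀ s ∈ Metric.sphere t (r t), s - t' ≠ 0 := by
    intro t' ht' s hs
    by_cases h : t' = t
    · rw [h]; exact sub_ne_zero.2 (hne s hs)
    · exact hst' t' ht' h s (hss hs)
  have hterm : ∀ t' ∈ D.roots.toFinset, ∀ j : Fin (n t'), ContinuousOn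
      (fun s : ℂ => c t' j * (((s - t') ^ (j.1 + 1))⁻¹ * (s - b)⁻¹)) (Metric.sphere t (r t)) :=
    fun t' ht' j => continuousOn_const.mul ((ContinuousOn.inv₀ (by fun_prop) fun s hs =>
      pow_ne_zero _ (hst t' ht' s hs)).mul hcb)
  have e : EqOn (fun s : ℂ => P.eval s / D.eval s * (s - b)⁻¹) (fun s : ℂ =>
      ∑ t' ∈ D.roots.toFinset, ∑ j, c t' j * (((s - t') ^ (j.1 + 1))⁻¹ * (s - b)⁻¹))
      (Metric.sphere t (r t)) := by
    intro s hs
    simp only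
    rw [hc s (hrD t ht s (hss hs) (hne s hs)), Finset.sum_mul]
    refine Finset.sum_congr rfl fun t' _ => ?_
    rw [Finset.sum_mul]
    exact Finset.sum_congr rfl fun j _ => by ring
  -- On the circle around t only the principal part at t contributes; the other ones are analytic on
  -- the closed disc.
  rw [circleIntegral.integral_congr hr0.le e, circleIntegral.integral_fun_sum fun t' ht' =>
    (continuousOn_finsetSum _ fun j _ => hterm t' ht' j).circleIntegrable hr0.le,
    Finset.sum_eq_single_of_mem t ht]
  · rw [circleIntegral.integral_fun_sum fun j _ => (hterm t ht j).circleIntegrable hr0.le,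
      Finset.mul_sum, ← Finset.sum_neg_distrib]
    refine Finset.sum_congr rfl fun j _ => ?_
    rw [circleIntegral.integral_const_mul, circleIntegral_inv_pow_mul_inv_sub hr0 (hrb t ht)]
    field_simp
  · intro t' ht' hne'
    refine DiffContOnCl.circleIntegral_eq_zero hr0.le (DifferentiableOn.diffContOnCl ?_)
    rw [closure_ball _ hr0.ne']
    refine DifferentiableOn.fun_sum fun j _ => DifferentiableOn.const_mul
      (DifferentiableOn.mul ?_ ?_) _
    · exact DifferentiableOn.inv (by fun_prop) fun s hs => pow_ne_zero _ (hst' t' ht' hne' s hs)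
    · exact DifferentiableOn.inv (by fun_prop) hsb

/-! ### Computing residues at isolated singularities -/

lemma complexResidue_eq_of_eventually {g : ℂ → ℂ} {t a : ℂ}
    (h : ∀ᶠ r : ℝ in 𝓝[>] 0, (2 * Real.pi * Complex.I)⁻¹ * ∮ s in C(t, r), g s = a) :
    complexResidue g t = a :=
  (tendsto_const_nhds.congr' (h.mono fun _ hr => hr.symm)).limUnder_eq

lemma eventually_sphere_of_eventually_nhdsNE {p : ℂ → Prop} {t : ℂ} (h : ∀ᶠ s in 𝓝[≠] t, p s) :
    ∀ᶠ r : ℝ in 𝓝[>] 0, ∀ s ∈ Metric.sphere t r, p s := by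
  rw [eventually_nhdsWithin_iff, Metric.eventually_nhds_iff] at h
  obtain ⟨ε, hε, hp⟩ := h
  filter_upwards [Ioo_mem_nhdsGT hε] with r hr s hs
  rw [Metric.mem_sphere] at hs
  refine hp (by rw [hs]; exact hr.2) fun hst => ?_
  rw [mem_singleton_iff.1 hst, dist_self] at hs
  exact hr.1.ne hs

/-- The residue is the integral over any circle around an isolated singularity. -/
lemma complexResidue_eq_circleIntegral {g G : ℂ → ℂ} {t : ℂ} (hgG : ∀ᶠ s in 𝓝[≠] t, g s = G s)
    {R : ℝ} (hR : 0 < R) (hG : ∀ s ∈ Metric.closedBall t R, s ≠ t → DifferentiableAt ℂ G s) :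
    complexResidue g t = (2 * Real.pi * Complex.I)⁻¹ * ∮ s in C(t, R), G s := by
  refine complexResidue_eq_of_eventually ?_
  filter_upwards [eventually_sphere_of_eventually_nhdsNE hgG, Ioo_mem_nhdsGT hR] with r hr hrR
  rw [circleIntegral.integral_congr hrR.1.le hr]
  congr 1
  have hd : ∀ s ∈ Metric.closedBall t R \ Metric.ball t r, DifferentiableAt ℂ G s := by
    intro s hs
    refine hG s hs.1 fun h => hs.2 ?_
    rw [h]
    exact Metric.mem_ball_self hrR.1
  refine (Complex.circleIntegral_eq_of_differentiable_on_annulus_off_countable hrR.1 hrR.2.le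
    countable_empty (fun s hs => (hd s hs).continuousAt.continuousWithinAt) ?_).symm
  rintro s ⟨⟨hs1, hs2⟩, -⟩
  exact hd s ⟨Metric.ball_subset_closedBall hs1, fun h => hs2 (Metric.ball_subset_closedBall h)⟩

/-- Cauchy's integral formula for h on small circles. -/
lemma complexResidue_of_simplePole {g h : ℂ → ℂ} {t : ℂ} (hh : AnalyticAt ℂ h t)
    (hg : ∀ᶠ s in 𝓝[≠] t, g s = (s - t)⁻¹ * h s) : complexResidue g t = h t := by
  refine complexResidue_eq_of_eventually ?_
  obtain ⟨ε, hε, hd⟩ := Metric.eventually_nhds_iff_ball.1 hh.eventually_analyticAt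
  filter_upwards [eventually_sphere_of_eventually_nhdsNE hg, Ioo_mem_nhdsGT hε] with r hr hrε
  have hdiff : DifferentiableOn ℂ h (Metric.closedBall t r) := fun s hs =>
    (hd s (Metric.closedBall_subset_ball hrε.2 hs)).differentiableAt.differentiableWithinAt
  have := hdiff.circleIntegral_sub_inv_smul (Metric.mem_ball_self hrε.1)
  simp only [smul_eq_mul] at this
  rw [circleIntegral.integral_congr hrε.1.le hr, this,
    inv_mul_cancel_left₀ Complex.two_pi_I_ne_zero]

/-! ### Behaviour of rational functions at infinity -/

/-- The quotient is the reversed polynomial at 1/s, and the constant coefficient of the reversed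
polynomial is the leading coefficient. -/
lemma Polynomial.tendsto_eval_div_pow_cocompact (p : Polynomial ℂ) :
    Tendsto (fun s => p.eval s / s ^ p.natDegree) (cocompact ℂ) (𝓝 p.leadingCoeff) := by
  have h1 : Tendsto (fun s : ℂ => p.reverse.eval s⁻¹) (cocompact ℂ) (𝓝 (p.reverse.eval 0)) :=
    (p.reverse.continuous.tendsto 0).comp (tendsto_inv₀_cobounded.mono_left
      (Metric.cobounded_eq_cocompact (α := ℂ)).ge)
  rw [← Polynomial.coeff_zero_eq_eval_zero, Polynomial.coeff_zero_reverse] at h1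
  refine h1.congr' ?_
  have h0 : ∀ᶠ s : ℂ in cocompact ℂ, s ≠ 0 := by
    have := (isCompact_singleton (x := (0 : ℂ))).compl_mem_cocompact
    filter_upwards [this] with s hs using hs
  filter_upwards [h0] with s hs
  let := invertibleOfNonzero hs
  have := Polynomial.eval₂_reverse_mul_pow (RingHom.id ℂ) s p
  rw [invOf_eq_inv] at this
  rw [eq_div_iff (pow_ne_zero _ hs)]
  exact this

lemma ratEval_eq (φ : RatFunc ℂ) (s : ℂ) : ratEval φ s = φ.num.eval s / φ.denom.eval s := rfl

/-- A rational function with `φ(∞) = ∞` has a numerator of larger degree than its denominator. -/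
lemma natDegree_denom_lt_natDegree_num {φ : RatFunc ℂ}
    (hinf : Tendsto (ratEval φ) (cocompact ℂ) (cocompact ℂ)) :
    φ.denom.natDegree < φ.num.natDegree := by
  by_contra! hle
  have hq := φ.denom.tendsto_eval_div_pow_cocompact
  have hp := φ.num.tendsto_eval_div_pow_cocompact
  have hlq : φ.denom.leadingCoeff ≠ 0 :=
    Polynomial.leadingCoeff_ne_zero.2 φ.denom_ne_zero
  have hdiv := (hp.div hq hlq).norm
  have hnorm : Tendsto (fun s => ‖ratEval φ s‖) (cocompact ℂ) atTop :=
    (tendsto_norm_cocompact_atTop (E := ℂ)).comp hinf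
  have h1 : ∀ᶠ s : ℂ in cocompact ℂ, 1 ≤ ‖s‖ :=
    (tendsto_norm_cocompact_atTop (E := ℂ)).eventually_ge_atTop 1
  -- With k the degree of the denominator minus that of the numerator, φ(s) s^k has a finite limit,
  -- although for |s| ≥ 1 its modulus is at least |φ(s)|, which tends to infinity.
  refine not_tendsto_nhds_of_tendsto_atTop (tendsto_atTop_mono' _ ?_ hnorm) _ hdiv
  filter_upwards [h1] with s hs
  have hs0 : s ≠ 0 := norm_pos_iff.1 (one_pos.trans_le hs)
  obtain ⟨k, hk⟩ := Nat.exists_eq_add_of_le hle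
  have e : φ.num.eval s / s ^ φ.num.natDegree / (φ.denom.eval s / s ^ φ.denom.natDegree) =
      ratEval φ s * s ^ k := by
    rw [ratEval_eq, hk, pow_add]
    field_simp
  simp only [Pi.div_apply]
  rw [e, norm_mul, norm_pow]
  exact le_mul_of_one_le_right (norm_nonneg _) (one_le_pow₀ hs)

/-- A rational function with `φ(∞) = ∞` grows at least linearly. -/
lemma exists_linear_growth {φ : RatFunc ℂ}
    (hinf : Tendsto (ratEval φ) (cocompact ℂ) (cocompact ℂ)) :
    ∃ c R₀ : ℝ, 0 < c ∧ ∀ s : ℂ, R₀ ≤ ‖s‖ → c * ‖s‖ ≤ ‖ratEval φ s‖ := by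
  have hlt := natDegree_denom_lt_natDegree_num hinf
  have hq := φ.denom.tendsto_eval_div_pow_cocompact
  have hp := φ.num.tendsto_eval_div_pow_cocompact
  have hlq : φ.denom.leadingCoeff ≠ 0 :=
    Polynomial.leadingCoeff_ne_zero.2 φ.denom_ne_zero
  have hlp : φ.num.leadingCoeff ≠ 0 := by
    rw [Polynomial.leadingCoeff_ne_zero]
    rintro h
    rw [h] at hlt
    simp at hlt
  have hdiv := (hp.div hq hlq).norm
  set a := ‖φ.num.leadingCoeff / φ.denom.leadingCoeff‖ with ha
  have ha0 : 0 < a := norm_pos_iff.2 (div_ne_zero hlp hlq)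
  have h1 : ∀ᶠ s : ℂ in cocompact ℂ, 1 ≤ ‖s‖ :=
    (tendsto_norm_cocompact_atTop (E := ℂ)).eventually_ge_atTop 1
  -- With k + 1 the excess of the numerator's degree, |φ(s)|/|s|^(k+1) tends to a > 0, so it
  -- eventually exceeds a/2; and |s|^(k+1) ≥ |s|.
  have h2 : ∀ᶠ s : ℂ in cocompact ℂ, a / 2 * ‖s‖ ≤ ‖ratEval φ s‖ := by
    filter_upwards [h1, hdiv.eventually (Ioi_mem_nhds (half_lt_self ha0))] with s hs hsa
    have hs0 : s ≠ 0 := norm_pos_iff.1 (one_pos.trans_le hs)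
    obtain ⟨k, hk⟩ := Nat.exists_eq_add_of_lt hlt
    have e : ratEval φ s = φ.num.eval s / s ^ φ.num.natDegree /
        (φ.denom.eval s / s ^ φ.denom.natDegree) * s ^ (k + 1) := by
      rw [ratEval_eq, hk, add_assoc, pow_add]
      field_simp
    rw [e, norm_mul, norm_pow]
    exact mul_le_mul (le_of_lt hsa) (le_self_pow₀ hs (by omega)) (norm_nonneg _) (norm_nonneg _)
  rw [← Metric.cobounded_eq_cocompact, ← comap_norm_atTop, eventually_comap] at h2
  obtain ⟨R₀, hR₀⟩ := eventually_atTop.1 h2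
  exact ⟨a / 2, R₀, by positivity, fun s hs => hR₀ _ hs s rfl⟩

/-! ### The conjugate symbol, its fibers and its critical points -/

namespace ConjSymbol

variable (φ : RatFunc ℂ)

/-- The numerator of `s ↦ conj (φ (conj s))`. -/
noncomputable def num : Polynomial ℂ := φ.num.map (starRingEnd ℂ)

/-- The denominator of `s ↦ conj (φ (conj s))`. -/
noncomputable def denom : Polynomial ℂ := φ.denom.map (starRingEnd ℂ)

/-- The numerator of `s ↦ conj (φ (conj s)) - z`. -/
noncomputable def fiberPoly (z : ℂ) : Polynomial ℂ := num φ - Polynomial.C z * denom φ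

lemma eval_map_conj (p : Polynomial ℂ) (s : ℂ) :
    (p.map (starRingEnd ℂ)).eval s = conj (p.eval (conj s)) := by
  rw [Polynomial.eval_map, ← Polynomial.eval₂_at_apply, Complex.conj_conj]

lemma conjSymbol_eq (s : ℂ) : conjSymbol φ s = (num φ).eval s / (denom φ).eval s := by
  rw [conjSymbol, ratEval_eq, map_div₀, num, denom, eval_map_conj, eval_map_conj]

lemma conjSymbol_eq_fun : conjSymbol φ = fun s => (num φ).eval s / (denom φ).eval s :=
  funext (conjSymbol_eq φ)

lemma eval_fiberPoly (z s : ℂ) :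
    (fiberPoly φ z).eval s = (num φ).eval s - z * (denom φ).eval s := by
  simp [fiberPoly]

lemma isCoprime : IsCoprime (num φ) (denom φ) :=
  φ.isCoprime_num_denom.map (Polynomial.mapRingHom (starRingEnd ℂ))

lemma conjSymbol_sub (z : ℂ) {s : ℂ} (hs : (denom φ).eval s ≠ 0) :
    conjSymbol φ s - z = (fiberPoly φ z).eval s / (denom φ).eval s := by
  rw [conjSymbol_eq, eval_fiberPoly]
  field_simp

variable {φ}

/-- A common zero of the fiber polynomial and the denominator would be a zero of the numerator too,
against coprimality. -/
lemma eval_denom_ne_zero_of_root {z t : ℂ} (ht : (fiberPoly φ z).eval t = 0) :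
    (denom φ).eval t ≠ 0 := by
  intro h
  obtain ⟨a, b, hab⟩ := isCoprime φ
  rw [eval_fiberPoly, h, mul_zero, sub_zero] at ht
  have := congrArg (Polynomial.eval t) hab
  simp [h, ht] at this

lemma natDegree_denom_lt (hinf : Tendsto (ratEval φ) (cocompact ℂ) (cocompact ℂ)) :
    (denom φ).natDegree < (num φ).natDegree := by
  rw [num, denom, Polynomial.natDegree_map, Polynomial.natDegree_map]
  exact natDegree_denom_lt_natDegree_num hinf

/-- Subtracting z times the denominator does not affect the larger degree of the numerator. This
makes 1/(ψ - z) a proper fraction, as `sum_circleIntegral_rational` requires. -/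
lemma degree_fiberPoly (hinf : Tendsto (ratEval φ) (cocompact ℂ) (cocompact ℂ)) (z : ℂ) :
    (denom φ).degree < (fiberPoly φ z).degree := by
  have h := Polynomial.degree_lt_degree (natDegree_denom_lt hinf)
  have h1 : (Polynomial.C z * denom φ).degree ≤ (denom φ).degree := by
    rw [← Polynomial.smul_eq_C_mul]
    exact Polynomial.degree_smul_le _ _
  rwa [fiberPoly, Polynomial.degree_sub_eq_left_of_degree_lt (h1.trans_lt h)]

lemma fiberPoly_ne_zero (hinf : Tendsto (ratEval φ) (cocompact ℂ) (cocompact ℂ)) (z : ℂ) :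
    fiberPoly φ z ≠ 0 := Polynomial.ne_zero_of_degree_gt (degree_fiberPoly hinf z)

section SelfMap

variable (hself : ∀ z : ℍ, 0 < (ratEval φ z).im)
include hself

/-- At a pole `ratEval` takes the value 0, which is not in the open half-plane; so the self-map
hypothesis already excludes poles of φ there, and of ψ in the lower half-plane. -/
lemma eval_denom_ne_zero {s : ℂ} (hs : s.im < 0) : (denom φ).eval s ≠ 0 := by
  intro h
  have h1 : 0 < (ratEval φ (conj s)).im := hself ⟨conj s, by simpa using hs⟩
  rw [denom, eval_map_conj, map_eq_zero] at h
  rw [ratEval_eq, h] at h1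
  simp at h1

lemma im_conjSymbol_neg {s : ℂ} (hs : s.im < 0) : (conjSymbol φ s).im < 0 := by
  have h1 : 0 < (ratEval φ (conj s)).im := hself ⟨conj s, by simpa using hs⟩
  rw [conjSymbol, Complex.conj_im]
  linarith

/-- On the real line this follows by approaching s from below along s - iε. -/
lemma im_conjSymbol_nonpos {s : ℂ} (hs : s.im ≤ 0) (hd : (denom φ).eval s ≠ 0) :
    (conjSymbol φ s).im ≤ 0 := by
  have hc : ContinuousAt (conjSymbol φ) s := by
    rw [conjSymbol_eq_fun]
    exact (num φ).continuous.continuousAt.div (denom φ).continuous.continuousAt hd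
  have h1 : Tendsto (fun ε : ℝ => s - ε * Complex.I) (𝓝[>] 0) (𝓝 s) := by
    have : Continuous fun ε : ℝ => s - ε * Complex.I := by fun_prop
    have := (this.tendsto 0).mono_left (nhdsWithin_le_nhds (s := Ioi 0))
    simpa using this
  have h2 := (Complex.continuous_im.tendsto _).comp (hc.tendsto.comp h1)
  refine le_of_tendsto h2 ?_
  filter_upwards [self_mem_nhdsWithin] with ε hε
  have hε' : 0 < ε := hε
  refine (im_conjSymbol_neg hself ?_).le
  simp; linarith

/-- In the closed lower half-plane the imaginary part of ψ is nonpositive where ψ is defined, so ψ =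
z has no solution there. Hence the fiber in the upper half-plane contains all poles of 1/(ψ - z),
which lets a sum of residues over the whole plane be used. -/
lemma im_pos_of_root (z : ℍ) {t : ℂ} (ht : (fiberPoly φ z).eval t = 0) : 0 < t.im := by
  by_contra! hle
  have hd := eval_denom_ne_zero_of_root ht
  have h1 := im_conjSymbol_nonpos hself hle hd
  have h2 := conjSymbol_sub φ z hd
  rw [ht, zero_div, sub_eq_zero] at h2
  rw [h2] at h1
  exact absurd z.im_pos (not_lt.2 h1)

lemma differentiableOn_ratEval : DifferentiableOn ℂ (ratEval φ) {z | 0 < z.im} := by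
  have : ratEval φ = fun s => φ.num.eval s / φ.denom.eval s := funext (ratEval_eq φ)
  rw [this]
  refine φ.num.differentiable.differentiableOn.div φ.denom.differentiable.differentiableOn
    fun s hs h => ?_
  have h1 : 0 < (ratEval φ s).im := hself ⟨s, hs⟩
  rw [ratEval_eq, h] at h1
  simp at h1

end SelfMap

lemma mem_conjFiber_iff (z t : ℍ) : t ∈ conjFiber φ z ↔ (fiberPoly φ z).eval (t : ℂ) = 0 := by
  have hmem : t ∈ conjFiber φ z ↔ conjSymbol φ t = z := Iff.rfl
  rw [hmem]
  constructor
  · intro h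
    have hd : (denom φ).eval (t : ℂ) ≠ 0 := by
      intro hd
      rw [conjSymbol_eq, hd, div_zero] at h
      exact z.ne_zero h.symm
    have := conjSymbol_sub φ z hd
    rw [h, sub_self, eq_comm, div_eq_zero_iff] at this
    exact this.resolve_right hd
  · intro h
    have := conjSymbol_sub φ z (eval_denom_ne_zero_of_root h)
    rwa [h, zero_div, sub_eq_zero] at this

lemma eventually_eval_denom_ne_zero {t : ℂ} (ht : (denom φ).eval t ≠ 0) :
    ∀ᶠ s in 𝓝 t, (denom φ).eval s ≠ 0 :=
  (denom φ).continuous.continuousAt.eventually_ne ht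

lemma analyticAt_conjSymbol {t : ℂ} (ht : (denom φ).eval t ≠ 0) : AnalyticAt ℂ (conjSymbol φ) t := by
  rw [conjSymbol_eq_fun]
  exact ((num φ).differentiable.analyticAt t).div ((denom φ).differentiable.analyticAt t) ht

/-- The numerator of the derivative of `s ↦ conj (φ (conj s))`. -/
noncomputable def derivPoly (φ : RatFunc ℂ) : Polynomial ℂ :=
  (num φ).derivative * denom φ - num φ * (denom φ).derivative

/-- If it vanished, coprimality would make the numerator divide its own derivative. By degrees the
derivative would be zero and the numerator constant, against its degree exceeding that of the
denominator. -/
lemma derivPoly_ne_zero (hinf : Tendsto (ratEval φ) (cocompact ℂ) (cocompact ℂ)) :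
    derivPoly φ ≠ 0 := by
  intro h
  have hlt := natDegree_denom_lt hinf
  rw [derivPoly, sub_eq_zero] at h
  have h1 : num φ ∣ (num φ).derivative :=
    (isCoprime φ).dvd_of_dvd_mul_right (h ▸ dvd_mul_right _ _)
  have h2 : (num φ).derivative = 0 := by
    by_contra hne
    have h3 := Polynomial.natDegree_le_of_dvd h1 hne
    have h4 := Polynomial.natDegree_derivative_lt (p := num φ) (by omega)
    omega
  have := Polynomial.derivative_eq_zero.1 h2
  omega

lemma deriv_conjSymbol {t : ℂ} (ht : (denom φ).eval t ≠ 0) :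
    deriv (conjSymbol φ) t = (derivPoly φ).eval t / (denom φ).eval t ^ 2 := by
  rw [conjSymbol_eq_fun]
  refine (((num φ).hasDerivAt t).div ((denom φ).hasDerivAt t) ht).deriv.trans ?_
  simp [derivPoly]

/-- Away from critical points ψ - z has a simple zero, so its reciprocal has a simple pole. -/
lemma meromorphicOrderAt_eq_neg_one {z t : ℍ} (ht : t ∈ conjFiber φ z)
    (hd : (derivPoly φ).eval (t : ℂ) ≠ 0) :
    meromorphicOrderAt (fun s : ℂ => 1 / (conjSymbol φ s - z)) t = -1 := by
  have hden := eval_denom_ne_zero_of_root ((mem_conjFiber_iff z t).1 ht)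
  have ha := analyticAt_conjSymbol hden
  have hord := ha.analyticOrderAt_sub_eq_one_of_deriv_ne_zero (by
    rw [deriv_conjSymbol hden]
    exact div_ne_zero hd (pow_ne_zero _ hden))
  have hz : conjSymbol φ t = z := ht
  rw [hz] at hord
  have e : (fun s : ℂ => 1 / (conjSymbol φ s - z)) = (fun s : ℂ => conjSymbol φ s - z)⁻¹ := by
    funext s
    simp
  rw [e, meromorphicOrderAt_inv, AnalyticAt.meromorphicOrderAt_eq (by fun_prop), hord]
  rfl

/-- The poles are simple off a finite set. -/
lemma finite_not_hasSimplePoles (hinf : Tendsto (ratEval φ) (cocompact ℂ) (cocompact ℂ)) :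
    {z : ℍ | ¬ HasSimplePoles φ z}.Finite := by
  have hfin : {t : ℂ | (derivPoly φ).IsRoot t}.Finite :=
    Polynomial.finite_setOfPred_isRoot (derivPoly_ne_zero hinf)
  -- An exceptional z is a critical value of ψ. `UpperHalfPlane.ofComplex` only serves to place the
  -- finitely many critical values in the half-plane.
  refine (hfin.image fun t => UpperHalfPlane.ofComplex (conjSymbol φ t)).subset fun z hz => ?_
  have hz' : ¬ HasSimplePoles φ z := hz
  rw [HasSimplePoles] at hz'
  push Not at hz'
  obtain ⟨t, ht, hord⟩ := hz'
  refine ⟨t, ?_, ?_⟩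
  · by_contra hd
    exact hord (meromorphicOrderAt_eq_neg_one ht hd)
  · have h : conjSymbol φ t = z := ht
    simp only [h, UpperHalfPlane.ofComplex_apply]

/-- The fiber, as the set of roots of a polynomial. -/
lemma image_conjFiber (hself : ∀ z : ℍ, 0 < (ratEval φ z).im)
    (hinf : Tendsto (ratEval φ) (cocompact ℂ) (cocompact ℂ)) (z : ℍ) :
    (fun t : ℍ => (t : ℂ)) '' conjFiber φ z = (fiberPoly φ z).roots.toFinset := by
  ext t
  simp only [mem_image, SetLike.mem_coe, Multiset.mem_toFinset,
    Polynomial.mem_roots (fiberPoly_ne_zero hinf z), Polynomial.IsRoot.def]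
  constructor
  · rintro ⟨t, ht, rfl⟩
    exact (mem_conjFiber_iff z t).1 ht
  · intro h
    exact ⟨⟨t, im_pos_of_root hself z h⟩, (mem_conjFiber_iff z _).2 h, rfl⟩

lemma finite_conjFiber (hself : ∀ z : ℍ, 0 < (ratEval φ z).im)
    (hinf : Tendsto (ratEval φ) (cocompact ℂ) (cocompact ℂ)) (z : ℍ) : (conjFiber φ z).Finite := by
  refine Set.Finite.of_finite_image ?_ (UpperHalfPlane.coe_injective.injOn)
  rw [image_conjFiber hself hinf z]
  exact Finset.finite_toSet _

end ConjSymbol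

/-! ### The residue sum as a bounded functional, and the adjoint -/

namespace HardyH2

lemma differentiableAt_ofComplex (f : HardyH2) {s : ℂ} (hs : 0 < s.im) :
    DifferentiableAt ℂ (fun s : ℂ => f (UpperHalfPlane.ofComplex s)) s :=
  f.2.1.differentiableAt hs

/-- Integration over a circle in the half-plane, against a continuous weight, is a bounded
functional on the Hardy space. -/
lemma exists_circleFunctional {t : ℂ} {r : ℝ} (hr : 0 < r)
    (him : ∀ s ∈ Metric.closedBall t r, 0 < s.im) {G : ℂ → ℂ}
    (hG : ContinuousOn G (Metric.sphere t r)) :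
    ∃ ℓ : HardyH2 →L[ℂ] ℂ, ∀ f : HardyH2, ℓ f = (2 * Real.pi * Complex.I)⁻¹ *
      ∮ s in C(t, r), f (UpperHalfPlane.ofComplex s) * G s := by
  have hss : Metric.sphere t r ⊆ Metric.closedBall t r := Metric.sphere_subset_closedBall
  have hint : ∀ f : HardyH2,
      CircleIntegrable (fun s => f (UpperHalfPlane.ofComplex s) * G s) t r := fun f =>
    ContinuousOn.circleIntegrable hr.le (ContinuousOn.mul (fun s hs =>
      (f.differentiableAt_ofComplex (him s (hss hs))).continuousAt.continuousWithinAt) hG)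
  -- The lowest point of the closed disc still has positive height, so the point evaluations are
  -- uniformly bounded on the disc; the factor 1/3 makes the inequality in `norm_apply_le` strict.
  obtain ⟨s₀, hs₀, hmin⟩ := (isCompact_closedBall t r).exists_isMinOn
    ⟨t, Metric.mem_closedBall_self hr.le⟩ Complex.continuous_im.continuousOn
  have hδ := him s₀ hs₀
  obtain ⟨C, hC, hCf⟩ := norm_apply_le (R := s₀.im / 3) (by positivity)
  obtain ⟨M, hM⟩ := (isCompact_sphere t r).exists_bound_of_continuousOn hG
  let L : HardyH2 →ₗ[ℂ] ℂ :=
    { toFun := fun f => (2 * Real.pi * Complex.I)⁻¹ *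
        ∮ s in C(t, r), f (UpperHalfPlane.ofComplex s) * G s
      map_add' := fun f g => by
        rw [← mul_add, ← circleIntegral.integral_add (hint f) (hint g)]
        congr 2
        funext s
        exact add_mul _ _ _
      map_smul' := fun a f => by
        rw [RingHom.id_apply, smul_eq_mul, mul_left_comm a,
          ← circleIntegral.integral_const_mul a]
        congr 2
        funext s
        exact mul_assoc _ _ _ }
  refine ⟨L.mkContinuous (r * (C * M)) fun f => ?_, fun f => rfl⟩
  have h := circleIntegral.norm_two_pi_i_inv_smul_integral_le_of_norm_le_const (c := t)
    (f := fun s => f (UpperHalfPlane.ofComplex s) * G s) hr.le (C := C * ‖f‖ * M) fun s hs => by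
      rw [norm_mul]
      refine mul_le_mul (hCf f _ ?_) (hM s hs) (norm_nonneg _) (by positivity)
      rw [UpperHalfPlane.ofComplex_apply_of_im_pos (him s (hss hs))]
      have : s₀.im ≤ s.im := hmin (hss hs)
      show 2 * (s₀.im / 3) < s.im
      linarith
  refine h.trans (le_of_eq ?_)
  ring

end HardyH2

namespace ConjSymbol

variable {φ : RatFunc ℂ}

/-- Fixing circles that do not depend on f turns the residue sum into one linear functional on H².
-/
lemma exists_radius (hself : ∀ z : ℍ, 0 < (ratEval φ z).im)
    (hinf : Tendsto (ratEval φ) (cocompact ℂ) (cocompact ℂ)) (z : ℍ) :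
    ∃ r : ℂ → ℝ, ∀ t ∈ (fiberPoly φ z).roots.toFinset, 0 < r t ∧
      ∀ s ∈ Metric.closedBall t (r t), 0 < s.im ∧ (s ≠ t → (fiberPoly φ z).eval s ≠ 0) := by
  have h : ∀ t : ℂ, ∃ r : ℝ, t ∈ (fiberPoly φ z).roots.toFinset → 0 < r ∧
      ∀ s ∈ Metric.closedBall t r, 0 < s.im ∧ (s ≠ t → (fiberPoly φ z).eval s ≠ 0) := by
    intro t
    by_cases ht : t ∈ (fiberPoly φ z).roots.toFinset
    · have hD := fiberPoly_ne_zero hinf (z : ℂ)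
      have him : 0 < t.im := im_pos_of_root hself z
        ((Polynomial.mem_roots hD).1 (Multiset.mem_toFinset.1 ht))
      have h1 : (((fiberPoly φ z).roots.toFinset.erase t : Finset ℂ) : Set ℂ)ᶜ ∈ 𝓝 t :=
        (Finset.finite_toSet _).isClosed.isOpen_compl.mem_nhds (by simp)
      obtain ⟨r, hr, hsub⟩ := Metric.nhds_basis_closedBall.mem_iff.1
        (inter_mem (isOpen_im_pos.mem_nhds him) h1)
      refine ⟨r, fun _ => ⟨hr, fun s hs => ⟨(hsub hs).1, fun hst h0 => (hsub hs).2 ?_⟩⟩⟩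
      exact Finset.mem_erase.2 ⟨hst, Multiset.mem_toFinset.2 ((Polynomial.mem_roots hD).2 h0)⟩
    · exact ⟨0, fun h => absurd h ht⟩
  choose r hr using h
  exact ⟨r, hr⟩

/-- Replaces 1/(ψ - z) by a quotient of polynomials. The two agree near t but may differ at poles of
ψ, where division by zero assigns ψ the value 0. -/
lemma eventually_div_eq {z t : ℍ} (ht : t ∈ conjFiber φ z) (f : HardyH2) :
    ∀ᶠ s : ℂ in 𝓝 (t : ℂ), f (UpperHalfPlane.ofComplex s) / (conjSymbol φ s - z) =
      f (UpperHalfPlane.ofComplex s) * ((denom φ).eval s / (fiberPoly φ z).eval s) := by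
  filter_upwards [eventually_eval_denom_ne_zero
    (eval_denom_ne_zero_of_root ((mem_conjFiber_iff z t).1 ht))] with s hs
  rw [conjSymbol_sub φ z hs, div_div_eq_mul_div, mul_div_assoc]

lemma meromorphicAt_div {z t : ℍ} (ht : t ∈ conjFiber φ z) (f : HardyH2) :
    MeromorphicAt (fun s : ℂ => f (UpperHalfPlane.ofComplex s) / (conjSymbol φ s - z)) t := by
  have h1 := analyticAt_conjSymbol (eval_denom_ne_zero_of_root ((mem_conjFiber_iff z t).1 ht))
  have h2 : AnalyticAt ℂ (fun s : ℂ => f (UpperHalfPlane.ofComplex s)) t :=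
    DifferentiableOn.analyticAt (s := {z : ℂ | 0 < z.im}) f.2.1 (isOpen_im_pos.mem_nhds t.im_pos)
  exact h2.meromorphicAt.div (h1.sub analyticAt_const).meromorphicAt

/-- The sum of the residues is a bounded functional, represented by the composition of the
reproducing kernel with the symbol. -/
lemma adjoint_apply_eq_finsum_residue (hself : ∀ z : ℍ, 0 < (ratEval φ z).im)
    (hinf : Tendsto (ratEval φ) (cocompact ℂ) (cocompact ℂ)) {Cφ : HardyH2 →L[ℂ] HardyH2}
    (hC : ∀ (f : HardyH2) (z : ℍ), Cφ f z = f ⟨ratEval φ z, hself z⟩) (f : HardyH2) (z : ℍ) :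
    (ContinuousLinearMap.adjoint Cφ f) z = ∑ᶠ t ∈ conjFiber φ z,
      complexResidue (fun s : ℂ => f (UpperHalfPlane.ofComplex s) / (conjSymbol φ s - z)) t := by
  have hD := fiberPoly_ne_zero hinf (z : ℂ)
  have hdeg := degree_fiberPoly hinf (z : ℂ)
  set D := fiberPoly φ z with hDdef
  set Q := denom φ with hQdef
  set S := D.roots.toFinset with hS
  obtain ⟨r, hr⟩ := exists_radius hself hinf z
  have hroot : ∀ t ∈ S, D.eval t = 0 := fun t ht =>
    (Polynomial.mem_roots hD).1 (Multiset.mem_toFinset.1 ht)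
  have hℓ : ∀ t : ℂ, ∃ ℓ : HardyH2 →L[ℂ] ℂ, t ∈ S → ∀ f : HardyH2, ℓ f =
      (2 * Real.pi * Complex.I)⁻¹ *
        ∮ s in C(t, r t), f (UpperHalfPlane.ofComplex s) * (Q.eval s / D.eval s) := by
    intro t
    by_cases ht : t ∈ S
    · have hcont : ContinuousOn (fun s => Q.eval s / D.eval s) (Metric.sphere t (r t)) := by
        refine Q.continuous.continuousOn.div D.continuous.continuousOn fun s hs => ?_
        refine ((hr t ht).2 s (Metric.sphere_subset_closedBall hs)).2 fun h => ?_
        rw [h, mem_sphere_iff_norm, sub_self, norm_zero] at hs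
        exact (hr t ht).1.ne hs
      obtain ⟨ℓ, h⟩ := HardyH2.exists_circleFunctional (hr t ht).1
        (fun s hs => ((hr t ht).2 s hs).1) hcont
      exact ⟨ℓ, fun _ => h⟩
    · exact ⟨0, fun h => absurd h ht⟩
  choose ℓ hℓ using hℓ
  set ρ : HardyH2 →L[ℂ] ℂ := ∑ t ∈ S, ℓ t with hρ
  have hres : ∑ᶠ t ∈ conjFiber φ z,
      complexResidue (fun s : ℂ => f (UpperHalfPlane.ofComplex s) / (conjSymbol φ s - z)) t =
      ρ f := by
    rw [← finsum_mem_image (g := fun t : ℍ => (t : ℂ)) (f := fun t : ℂ => complexResidue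
      (fun s : ℂ => f (UpperHalfPlane.ofComplex s) / (conjSymbol φ s - z)) t)
      UpperHalfPlane.coe_injective.injOn, image_conjFiber hself hinf z, finsum_mem_coe_finset,
      hρ, sum_apply]
    refine Finset.sum_congr rfl fun t ht => ?_
    have him : 0 < t.im := im_pos_of_root hself z (hroot t ht)
    have hmem : (⟨t, him⟩ : ℍ) ∈ conjFiber φ z := (mem_conjFiber_iff z _).2 (hroot t ht)
    rw [hℓ t ht, complexResidue_eq_circleIntegral
      ((eventually_div_eq hmem f).filter_mono nhdsWithin_le_nhds) (hr t ht).1]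
    intro s hs hst
    exact (f.differentiableAt_ofComplex ((hr t ht).2 s hs).1).mul
      (Q.differentiable.differentiableAt.div D.differentiable.differentiableAt
        (((hr t ht).2 s hs).2 hst))
  -- On a kernel k_w the integrand is rational, with conj w as its only pole outside the fiber, so
  -- the sum over the fiber is minus the residue at conj w.
  have hker : ∀ w : ℍ, ρ (HardyH2.kernel w) = conj (Cφ (HardyH2.kernel z) w) := by
    intro w
    have hbim : (conj (w : ℂ)).im < 0 := by simpa using w.im_pos
    have hQb := eval_denom_ne_zero hself hbim
    have hDb : D.eval (conj (w : ℂ)) ≠ 0 := fun h => by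
      have := im_pos_of_root hself z h
      linarith
    have hsum := sum_circleIntegral_rational hD hdeg hDb (r := r) (fun t ht => (hr t ht).1)
      (fun t ht => by
        by_contra! hle
        have := ((hr t ht).2 (conj (w : ℂ)) (by rwa [mem_closedBall_iff_norm])).1
        linarith)
      (fun t ht s hs => ((hr t ht).2 s hs).2)
    have e : ρ (HardyH2.kernel w) = Complex.I / (2 * Real.pi) *
        -(Q.eval (conj (w : ℂ)) / D.eval (conj (w : ℂ))) := by
      rw [← hsum, Finset.mul_sum, hρ, sum_apply]
      refine Finset.sum_congr rfl fun t ht => ?_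
      rw [hℓ t ht, mul_left_comm (Complex.I / _),
        ← circleIntegral.integral_const_mul (Complex.I / _)]
      congr 1
      refine circleIntegral.integral_congr (hr t ht).1.le fun s hs => ?_
      rw [HardyH2.kernel_apply, UpperHalfPlane.ofComplex_apply_of_im_pos
        ((hr t ht).2 s (Metric.sphere_subset_closedBall hs)).1, ← div_div]
      ring
    have hψ := conjSymbol_sub φ z hQb
    have h1 : conjSymbol φ (conj (w : ℂ)) = conj (ratEval φ w) := by
      rw [conjSymbol, Complex.conj_conj]
    rw [h1] at hψ
    have hinv : Q.eval (conj (w : ℂ)) / D.eval (conj (w : ℂ)) = (conj (ratEval φ w) - z)⁻¹ := by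
      rw [hψ, inv_div]
    rw [e, hC, HardyH2.kernel_apply, hinv]
    simp only [map_div₀, map_mul, map_sub, Complex.conj_conj, Complex.conj_I, Complex.conj_ofReal,
      map_ofNat]
    rw [mul_neg, ← div_eq_mul_inv, div_div, neg_div]
  -- The Riesz representative of ρ is identified pointwise: its value at w is its inner product with
  -- k_w, that is, the conjugate of ρ(k_w).
  have hv : (InnerProductSpace.toDual ℂ HardyH2).symm ρ = Cφ (HardyH2.kernel z) := by
    refine HardyH2.ext fun w => ?_
    rw [← HardyH2.inner_kernel w, ← inner_conj_symm, InnerProductSpace.toDual_symm_apply, hker,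
      Complex.conj_conj]
  rw [hres, ← HardyH2.inner_kernel z, ContinuousLinearMap.adjoint_inner_right, ← hv,
    InnerProductSpace.toDual_symm_apply]

end ConjSymbol

/-! ### The adjoint formulas -/

theorem mainTheorem6 (φ : RatFunc ℂ) (hself : ∀ z : ℍ, 0 < (ratEval φ z).im)
    (hinf : Tendsto (ratEval φ) (cocompact ℂ) (cocompact ℂ)) :
    -- `Cφ` is the composition operator with symbol `φ`, a bounded operator on `H²`
    ∃ Cφ : HardyH2 →L[ℂ] HardyH2,
      (∀ (f : HardyH2) (z : ℍ), Cφ f z = f ⟨ratEval φ z, hself z⟩) ∧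
      -- the sums below are finite, and the residues are those of meromorphic functions
      (∀ z : ℍ, (conjFiber φ z).Finite) ∧
      (∀ (f : HardyH2) (z : ℍ), ∀ t ∈ conjFiber φ z,
        MeromorphicAt (fun s : ℂ => f (UpperHalfPlane.ofComplex s) / (conjSymbol φ s - z)) t) ∧
      -- the residue formula
      (∀ (f : HardyH2) (z : ℍ),
        (ContinuousLinearMap.adjoint Cφ f) z =
          ∑ᶠ t ∈ conjFiber φ z,
            complexResidue
              (fun s : ℂ => f (UpperHalfPlane.ofComplex s) / (conjSymbol φ s - z)) t) ∧
      -- the weighted composition formula where the poles are simple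
      (∀ z : ℍ, HasSimplePoles φ z →
        ∃ w : ℍ → ℂ,
          (∀ t ∈ conjFiber φ z,
            Tendsto (fun s : ℂ => (s - t) / (conjSymbol φ s - z)) (𝓝[≠] (t : ℂ)) (𝓝 (w t))) ∧
          ∀ f : HardyH2,
            (ContinuousLinearMap.adjoint Cφ f) z = ∑ᶠ t ∈ conjFiber φ z, w t * f t) ∧
      -- which is the case off a finite set
      {z : ℍ | ¬ HasSimplePoles φ z}.Finite := by
  obtain ⟨c, R₀, hc, hgrow⟩ := exists_linear_growth hinf
  obtain ⟨Cφ, hC⟩ := HardyH2.exists_compositionOperator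
    (ConjSymbol.differentiableOn_ratEval hself) hself hc (fun s _ => hgrow s)
  refine ⟨Cφ, hC, ConjSymbol.finite_conjFiber hself hinf,
    fun f z t ht => ConjSymbol.meromorphicAt_div ht f,
    ConjSymbol.adjoint_apply_eq_finsum_residue hself hinf hC, fun z hz => ?_,
    ConjSymbol.finite_not_hasSimplePoles hinf⟩
  have hpole : ∀ t : ℍ, ∃ g : ℂ → ℂ, t ∈ conjFiber φ z → AnalyticAt ℂ g t ∧
      ∀ᶠ s : ℂ in 𝓝[≠] (t : ℂ), 1 / (conjSymbol φ s - z) = (s - t)⁻¹ * g s := by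
    intro t
    by_cases ht : t ∈ conjFiber φ z
    · have hmer : MeromorphicAt (fun s : ℂ => 1 / (conjSymbol φ s - z)) t :=
        analyticAt_const.meromorphicAt.div ((ConjSymbol.analyticAt_conjSymbol
          (ConjSymbol.eval_denom_ne_zero_of_root ((ConjSymbol.mem_conjFiber_iff z t).1 ht))).sub
            analyticAt_const).meromorphicAt
      obtain ⟨g, hg, -, h⟩ := (meromorphicOrderAt_eq_int_iff (n := -1) hmer).1 (hz t ht)
      exact ⟨g, fun _ => ⟨hg, h.mono fun s hs => by simpa using hs⟩⟩
    · exact ⟨0, fun h => absurd h ht⟩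
  choose g hg using hpole
  -- With 1/(ψ - z) = g/(s - t) near t, the value g(t) is the limit of (s - t)/(ψ(s) - z), and g(t)
  -- f(t) is the residue of f/(ψ - z).
  refine ⟨fun t => g t t, fun t ht => ?_, fun f => ?_⟩
  · refine ((hg t ht).1.continuousAt.tendsto.mono_left nhdsWithin_le_nhds).congr' ?_
    filter_upwards [(hg t ht).2, self_mem_nhdsWithin] with s hs hst
    rw [div_eq_mul_one_div, hs, mul_inv_cancel_left₀ (sub_ne_zero.2 hst)]
  · rw [ConjSymbol.adjoint_apply_eq_finsum_residue hself hinf hC]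
    refine finsum_mem_congr rfl fun t ht => ?_
    have hf : AnalyticAt ℂ (fun s : ℂ => f (UpperHalfPlane.ofComplex s)) t :=
      DifferentiableOn.analyticAt (s := {z : ℂ | 0 < z.im}) f.2.1
        (isOpen_im_pos.mem_nhds t.im_pos)
    rw [complexResidue_of_simplePole ((hg t ht).1.mul hf)]
    · simp
    · filter_upwards [(hg t ht).2] with s hs
      rw [div_eq_mul_one_div, hs]
      simp only [Pi.mul_apply]
      ring
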